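/- Let $q\in\mathbb{C}$ be nonzero and not a root of unity. Let $U_q(\mathfrak{s})$ be the quantum Schrödinger algebra: the associative unital $\mathbb{C}$-algebra generated by $E,F,K,K^{-1},X,Y,Z$ with $KK^{-1}=K^{-1}K=1$, $Z$ central, and relations $$EF-FE=\frac{K-K^{-1}}{q-q^{-1}},\quad KEK^{-1}=q^2E,\quad KFK^{-1}=q^{-2}F,\quad KXK^{-1}=qX,\quad KYK^{-1}=q^{-1}Y,$$ $$qYX-XY=Z,\quad EX=qXE,\quad EY=X+q^{-1}YE,\quad FX=YK^{-1}+XF,\quad FY=YF.$$ A $U_q(\mathfrak{s})$-module $M$ is a weight module if it is the direct sum of its weight spaces $M_\lambda=\{v\in M: Kv=\lambda v\}$, $\lambda\in\mathbb{C}^*$; a weight module is of type $1$ if $M_\lambda\neq 0$ implies $\lambda\in q^{\mathbb{Z}}$. Consider the following full subcategories of the category of left $U_q(\mathfrak{s})$-modules: * $\mathcal{A}$: the finite-dimensional modules of type $1$ on which $Z$ acts by zero; * $\mathcal{O}[0]$: the finitely generated weight modules $M$ such that $U_q(\mathfrak{n}^+)v$ is finite-dimensional for every $v\in M$, where $U_q(\mathfrak{n}^+)$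 is the subalgebra generated by $E$ and $X$, and on which $Z$ acts locally nilpotently; * the category of all finite-dimensional $U_q(\mathfrak{s})$-modules. These categories are abelian. A $\mathbb{C}$-linear abelian category $\mathcal{C}$ is called wild if there is an exact $\mathbb{C}$-linear functor from the category of finite-dimensional representations of the free associative algebra $\mathbb{C}\langle x_1,x_2\rangle$ to $\mathcal{C}$ which sends indecomposable representations to indecomposable objects and nonisomorphic representations to nonisomorphic objects. Then the category $\mathcal{A}$ is wild; moreover, $\mathcal{O}[0]$ and the category of all finite-dimensional $U_q(\mathfrak{s})$-modules are wild. -/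

import Mathlib

open CategoryTheory CategoryTheory.Limits

namespace QuantumSchrodinger

/-- The generators `E, F, K, K⁻¹, X, Y, Z` of the quantum Schrödinger algebra. -/
inductive Gen : Type
  | E | F | K | Kinv | X | Y | Z

/-- A generator, as an element of the free associative algebra on all generators. -/
abbrev gen (g : Gen) : FreeAlgebra ℂ Gen := FreeAlgebra.ι ℂ g

/-- The defining relations of the quantum Schrödinger algebra. -/
inductive Rel (q : ℂˣ) : FreeAlgebra ℂ Gen → FreeAlgebra ℂ Gen → Prop
  | K_Kinv : Rel q (gen .K * gen .Kinv) 1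
  | Kinv_K : Rel q (gen .Kinv * gen .K) 1
  | E_F : Rel q (gen .E * gen .F - gen .F * gen .E)
      (((q : ℂ) - (q : ℂ)⁻¹)⁻¹ • (gen .K - gen .Kinv))
  | K_X : Rel q (gen .K * gen .X * gen .Kinv) ((q : ℂ) • gen .X)
  | K_E : Rel q (gen .K * gen .E * gen .Kinv) ((q : ℂ) ^ 2 • gen .E)
  | K_F : Rel q (gen .K * gen .F * gen .Kinv) (((q : ℂ) ^ 2)⁻¹ • gen .F)
  | K_Y : Rel q (gen .K * gen .Y * gen .Kinv) ((q : ℂ)⁻¹ • gen .Y)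
  | Y_X : Rel q ((q : ℂ) • (gen .Y * gen .X) - gen .X * gen .Y) (gen .Z)
  | E_X : Rel q (gen .E * gen .X) ((q : ℂ) • (gen .X * gen .E))
  | E_Y : Rel q (gen .E * gen .Y) (gen .X + (q : ℂ)⁻¹ • (gen .Y * gen .E))
  | F_X : Rel q (gen .F * gen .X) (gen .Y * gen .Kinv + gen .X * gen .F)
  | F_Y : Rel q (gen .F * gen .Y) (gen .Y * gen .F)
  | Z_central (g : Gen) : Rel q (gen .Z * gen g) (gen g * gen .Z)

/-- The quantum Schrödinger algebra `U_q(𝔰)` over `ℂ`. -/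
def Uq (q : ℂˣ) : Type := RingQuot (Rel q)

noncomputable instance (q : ℂˣ) : Ring (Uq q) := inferInstanceAs (Ring (RingQuot (Rel q)))

noncomputable instance (q : ℂˣ) : Algebra ℂ (Uq q) :=
  inferInstanceAs (Algebra ℂ (RingQuot (Rel q)))

/-- The quotient map from the free algebra onto `U_q(𝔰)`. -/
noncomputable def Uq.mk (q : ℂˣ) : FreeAlgebra ℂ Gen →ₐ[ℂ] Uq q := RingQuot.mkAlgHom ℂ (Rel q)

/-- The image of a generator in `U_q(𝔰)`. -/
noncomputable def u (q : ℂˣ) (g : Gen) : Uq q := Uq.mk q (gen g)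

/-- `U_q(𝔫⁺)`, the subalgebra of `U_q(𝔰)` generated by `E` and `X`. -/
noncomputable def nPlus (q : ℂˣ) : Subalgebra ℂ (Uq q) := Algebra.adjoin ℂ {u q .E, u q .X}

section Modules

variable (q : ℂˣ) (M : Type) [AddCommGroup M] [Module ℂ M] [Module (Uq q) M]
  [IsScalarTower ℂ (Uq q) M]

/-- The weight space `M_μ = {v ∈ M | K v = μ v}`. -/
noncomputable def weightSpace (μ : ℂˣ) : Submodule ℂ M :=
  Module.End.eigenspace (Algebra.lsmul ℂ ℂ M (u q .K)) (μ : ℂ)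

/-- `M` is a weight module: it is spanned by its weight spaces. (The sum of the weight spaces is
always direct, as they are eigenspaces of one operator for distinct eigenvalues.) -/
def IsWeight : Prop := ⨆ μ : ℂˣ, weightSpace q M μ = ⊤

/-- The support of `M`, the set of its weights. -/
def supp : Set ℂˣ := {μ | weightSpace q M μ ≠ ⊥}

/-- `M` is a weight module of type `1`: all its weights are integral powers of `q`. -/
def IsTypeOne : Prop := IsWeight q M ∧ supp q M ⊆ Set.range (fun n : ℤ => q ^ n)

variable {M} in
/-- The subspace `U_q(𝔫⁺) v` of `M`. -/
noncomputable def nPlusOrbit (v : M) : Submodule ℂ M :=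
  (Subalgebra.toSubmodule (nPlus q)).map
    ((LinearMap.toSpanSingleton (Uq q) M v).restrictScalars ℂ)

/-- `M` belongs to the category `𝒪`: it is a finitely generated weight module on which
`U_q(𝔫⁺)` acts locally finitely. -/
structure IsCategoryO : Prop where
  finite : Module.Finite (Uq q) M
  weight : IsWeight q M
  locallyFinite : ∀ v : M, FiniteDimensional ℂ (nPlusOrbit q v)

/-- `M` belongs to `𝒪[0]`: it belongs to `𝒪` and `Z` acts locally nilpotently on it. -/
def IsCategoryO0 : Prop := IsCategoryO q M ∧ ∀ v : M, ∃ n : ℕ, u q .Z ^ n • v = 0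

/-- `M` belongs to `𝒜`: it is finite-dimensional, of type `1`, and `Z` acts on it by zero. -/
structure IsCategoryA : Prop where
  finite : FiniteDimensional ℂ M
  typeOne : IsTypeOne q M
  zero : ∀ v : M, u q .Z • v = 0

end Modules

/-! ### The categories

A module over a `ℂ`-algebra `A` is regarded as a vector space over `ℂ` through `ℂ → A`. -/

open scoped ModuleCat in
/-- The finite-dimensional modules over a `ℂ`-algebra. -/
def isFD (A : Type) [Ring A] [Algebra ℂ A] : ObjectProperty (ModuleCat.{0} A) :=
  fun M => FiniteDimensional ℂ M

open scoped ModuleCat in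
/-- The modules of the category `𝒜`. -/
def isA (q : ℂˣ) : ObjectProperty (ModuleCat.{0} (Uq q)) := fun M => IsCategoryA q M

open scoped ModuleCat in
/-- The modules of the category `𝒪[0]`. -/
def isO0 (q : ℂˣ) : ObjectProperty (ModuleCat.{0} (Uq q)) := fun M => IsCategoryO0 q M

/-- The category of finite-dimensional modules over a `ℂ`-algebra. -/
abbrev FDMod (A : Type) [Ring A] [Algebra ℂ A] := (isFD A).FullSubcategory

/-- The category `𝒜` of finite-dimensional `U_q(𝔰)`-modules of type `1` with zero action of `Z`,
a full subcategory of the category of `U_q(𝔰)`-modules. -/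
abbrev CatA (q : ℂˣ) := (isA q).FullSubcategory

/-- The category `𝒪[0]`, a full subcategory of the category of `U_q(𝔰)`-modules. -/
abbrev CatO0 (q : ℂˣ) := (isO0 q).FullSubcategory

/-! ### These categories are abelian -/

section Relations

variable (q : ℂˣ)

lemma rel {a b : FreeAlgebra ℂ Gen} (h : Rel q a b) :
    Uq.mk q a = Uq.mk q b :=
  RingQuot.mkAlgHom_rel ℂ h

lemma K_Kinv : u q .K * u q .Kinv = 1 := by simpa [u] using rel q .K_Kinv

lemma Kinv_K : u q .Kinv * u q .K = 1 := by simpa [u] using rel q .Kinv_K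

/-- If `K a K⁻¹ = c a` with `c ≠ 0` then `K a = c a K` and `K⁻¹ a = c⁻¹ a K⁻¹`. -/
lemma conj_K {a : Uq q} {c : ℂ} (hc : c ≠ 0) (h : u q .K * a * u q .Kinv = c • a) :
    u q .K * a = c • (a * u q .K) ∧ u q .Kinv * a = c⁻¹ • (a * u q .Kinv) := by
  constructor
  · calc u q .K * a = u q .K * a * u q .Kinv * u q .K := by
          rw [mul_assoc (u q .K * a), Kinv_K, mul_one]
      _ = _ := by rw [h, smul_mul_assoc]
  · have : a * u q .Kinv = c • (u q .Kinv * a) := by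
      calc a * u q .Kinv = u q .Kinv * (u q .K * a * u q .Kinv) := by
            rw [← mul_assoc, ← mul_assoc, Kinv_K, one_mul]
        _ = _ := by rw [h, mul_smul_comm]
    rw [this, smul_smul, inv_mul_cancel₀ hc, one_smul]

lemma K_X : u q .K * u q .X * u q .Kinv = (q : ℂ) • u q .X := by
  simpa [u] using rel q .K_X

lemma K_E : u q .K * u q .E * u q .Kinv = (q : ℂ) ^ 2 • u q .E := by
  simpa [u] using rel q .K_E

lemma K_F : u q .K * u q .F * u q .Kinv = ((q : ℂ) ^ 2)⁻¹ • u q .F := by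
  simpa only [u, map_mul, map_smul] using rel q .K_F

lemma K_Y : u q .K * u q .Y * u q .Kinv = (q : ℂ)⁻¹ • u q .Y := by
  simpa only [u, map_mul, map_smul] using rel q .K_Y

lemma E_F : u q .E * u q .F =
    u q .F * u q .E + ((q : ℂ) - (q : ℂ)⁻¹)⁻¹ • (u q .K - u q .Kinv) := by
  have := rel q .E_F
  simp only [map_sub, map_mul, map_smul] at this
  exact sub_eq_iff_eq_add'.mp this

lemma X_Y : u q .X * u q .Y = (q : ℂ) • (u q .Y * u q .X) - u q .Z := by
  have := rel q .Y_X
  simp only [map_sub, map_mul, map_smul] at this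
  rw [u, u, u, ← this]; abel

lemma E_Y : u q .E * u q .Y = u q .X + (q : ℂ)⁻¹ • (u q .Y * u q .E) := by
  simpa only [u, map_add, map_mul, map_smul] using rel q .E_Y

lemma X_F : u q .X * u q .F = u q .F * u q .X - u q .Y * u q .Kinv := by
  have := rel q .F_X
  simp only [map_add, map_mul] at this
  rw [u, u, u, u, this]; abel

lemma F_Y : u q .F * u q .Y = u q .Y * u q .F := by
  simpa only [u, map_mul] using rel q .F_Y

lemma Z_comm (g : Gen) : u q .Z * u q g = u q g * u q .Z := by
  simpa only [u, map_mul] using rel q (.Z_central g)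

lemma adjoin_range_u : Algebra.adjoin ℂ (Set.range (u q)) = ⊤ := by
  have h1 : Set.range (u q) = Uq.mk q '' Set.range (FreeAlgebra.ι ℂ) := by
    rw [← Set.range_comp]; rfl
  rw [h1, ← AlgHom.map_adjoin, FreeAlgebra.adjoin_range_ι, Algebra.map_top,
    AlgHom.range_eq_top]
  exact RingQuot.mkAlgHom_surjective ℂ _

end Relations

section Noetherian

variable (q : ℂˣ) {M : Type} [AddCommGroup M] [Module ℂ M] [Module (Uq q) M]
  [IsScalarTower ℂ (Uq q) M]

/-- The commutative subalgebra generated by `F`, `Y` and `Z`. -/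
noncomputable def nMinusZ : Subalgebra ℂ (Uq q) :=
  Algebra.adjoin ℂ {u q .F, u q .Y, u q .Z}

lemma isNoetherianRing_nMinusZ : IsNoetherianRing (nMinusZ q) := by
  have hcomm : ∀ a ∈ ({u q .F, u q .Y, u q .Z} : Set (Uq q)),
      ∀ b ∈ ({u q .F, u q .Y, u q .Z} : Set (Uq q)), a * b = b * a := by
    rintro a (rfl | rfl | rfl) b (rfl | rfl | rfl) <;>
      simp only [F_Y, Z_comm]
  have hmc : IsMulCommutative (nMinusZ q) := Algebra.isMulCommutative_adjoin ℂ hcomm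
  let _ : CommRing (nMinusZ q) :=
    { (inferInstance : Ring (nMinusZ q)) with mul_comm := fun a b => hmc.is_comm.comm a b }
  let _ : Algebra ℂ (nMinusZ q) := (nMinusZ q).algebra
  have hfg : (nMinusZ q).FG := Subalgebra.fg_def.2 ⟨_, Set.toFinite _, rfl⟩
  have : Algebra.FiniteType ℂ (nMinusZ q) := ⟨(Subalgebra.fg_top _).2 hfg⟩
  exact Algebra.FiniteType.isNoetherianRing ℂ (nMinusZ q)

lemma nPlusOrbit_stable {v : M} {a : Uq q} (ha : a ∈ nPlus q) {w : M}
    (hw : w ∈ nPlusOrbit q v) : a • w ∈ nPlusOrbit q v := by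
  obtain ⟨b, hb, rfl⟩ := hw
  exact ⟨a * b, (nPlus q).mul_mem ha hb, by simp [mul_smul]⟩

lemma mem_nPlusOrbit (v : M) : v ∈ nPlusOrbit q v :=
  ⟨1, (nPlus q).one_mem, by simp⟩

lemma nPlusOrbit_K {v : M} {c : ℂ} {k : Uq q} (hv : k • v = c • v) {d e : ℂ}
    (hE : k * u q .E = d • (u q .E * k)) (hX : k * u q .X = e • (u q .X * k))
    {w : M} (hw : w ∈ nPlusOrbit q v) : k • w ∈ nPlusOrbit q v := by
  obtain ⟨b, hb, rfl⟩ := hw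
  have key : ∀ b ∈ nPlus q, ∀ w ∈ nPlusOrbit q v, k • w ∈ nPlusOrbit q v →
      k • (b • w) ∈ nPlusOrbit q v := by
    intro b hb
    induction hb using Algebra.adjoin_induction with
    | mem x hx =>
      intro w hw hkw
      rcases hx with rfl | rfl
      · rw [← mul_smul, hE, smul_assoc, mul_smul]
        exact Submodule.smul_mem _ _
          (nPlusOrbit_stable q (Algebra.subset_adjoin (by simp)) hkw)
      · rw [← mul_smul, hX, smul_assoc, mul_smul]
        exact Submodule.smul_mem _ _
          (nPlusOrbit_stable q (Algebra.subset_adjoin (by simp)) hkw)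
    | algebraMap r =>
      intro w hw hkw
      rw [← mul_smul, ← Algebra.commutes, mul_smul, algebraMap_smul]
      exact Submodule.smul_mem _ _ hkw
    | add x y _ _ hx hy =>
      intro w hw hkw
      rw [add_smul, smul_add]
      exact Submodule.add_mem _ (hx w hw hkw) (hy w hw hkw)
    | mul x y hxm hym hx hy =>
      intro w hw hkw
      rw [mul_smul]
      exact hx _ (nPlusOrbit_stable q hym hw) (hy w hw hkw)
  refine key b hb v (mem_nPlusOrbit q v) ?_
  rw [hv]
  exact Submodule.smul_mem _ _ (mem_nPlusOrbit q v)

lemma mem_weightSpace {μ : ℂˣ} {v : M} : v ∈ weightSpace q M μ ↔ u q .K • v = (μ : ℂ) • v := by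
  simp [weightSpace]

lemma Kinv_weight {μ : ℂˣ} {v : M} (hv : v ∈ weightSpace q M μ) :
    u q .Kinv • v = (μ : ℂ)⁻¹ • v := by
  have h := (mem_weightSpace q).mp hv
  have h2 : v = (μ : ℂ) • (u q .Kinv • v) := by
    calc v = u q .Kinv • (u q .K • v) := by rw [← mul_smul, Kinv_K, one_smul]
      _ = _ := by rw [h, smul_algebra_smul_comm]
  conv_rhs => rw [h2]
  rw [smul_smul, inv_mul_cancel₀ μ.ne_zero, one_smul]

/-- A module in `𝒪` is finitely generated over the algebra generated by `F`, `Y`, `Z`. -/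
lemma IsCategoryO.finite_nMinusZ (h : IsCategoryO q M) : Module.Finite (nMinusZ q) M := by
  have hq : (q : ℂ) ≠ 0 := q.ne_zero
  -- finitely many weight vectors generate
  let H : Set M := {v | ∃ μ : ℂˣ, v ∈ weightSpace q M μ}
  have hH : Submodule.span (Uq q) H = ⊤ := by
    have h1 : (⊤ : Submodule ℂ M) ≤ (Submodule.span (Uq q) H).restrictScalars ℂ := by
      have hw : ⨆ μ : ℂˣ, weightSpace q M μ = ⊤ := h.weight
      rw [← hw]
      exact iSup_le fun μ v hv => Submodule.subset_span ⟨μ, hv⟩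
    exact eq_top_iff.mpr fun v _ => h1 (Submodule.mem_top (x := v))
  have hfg : (Submodule.span (Uq q) H).FG := by rw [hH]; exact h.finite.fg_top
  obtain ⟨S, hSH, hS⟩ := (Submodule.fg_span_iff_fg_span_finset_subset H).mp hfg
  rw [hH] at hS
  let W : Submodule ℂ M := ⨆ v : S, nPlusOrbit q (v : M)
  have : ∀ v : S, FiniteDimensional ℂ (nPlusOrbit q (v : M)) := fun v => h.locallyFinite v
  have : FiniteDimensional ℂ W := Submodule.finiteDimensional_iSup _
  have hWst : ∀ a : Uq q, (∀ v : S, ∀ w ∈ nPlusOrbit q (v : M), a • w ∈ nPlusOrbit q (v : M)) →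
      ∀ w ∈ W, a • w ∈ W := by
    intro a ha w hw
    have : W ≤ W.comap (Algebra.lsmul ℂ ℂ M a) :=
      iSup_le fun v w hw => Submodule.mem_iSup_of_mem v (ha v w hw)
    exact this hw
  have hWE : ∀ w ∈ W, u q .E • w ∈ W := hWst _ fun v w hw =>
    nPlusOrbit_stable q (Algebra.subset_adjoin (by simp)) hw
  have hWX : ∀ w ∈ W, u q .X • w ∈ W := hWst _ fun v w hw =>
    nPlusOrbit_stable q (Algebra.subset_adjoin (by simp)) hw
  have hcE := conj_K q (pow_ne_zero 2 hq) (K_E q)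
  have hcX := conj_K q hq (K_X q)
  have hcF := conj_K q (inv_ne_zero (pow_ne_zero 2 hq)) (K_F q)
  have hcY := conj_K q (inv_ne_zero hq) (K_Y q)
  have hWK : ∀ w ∈ W, u q .K • w ∈ W := hWst _ fun v w hw => by
    obtain ⟨μ, hμ⟩ := hSH v.2
    exact nPlusOrbit_K q ((mem_weightSpace q).mp hμ) hcE.1 hcX.1 hw
  have hWK' : ∀ w ∈ W, u q .Kinv • w ∈ W := hWst _ fun v w hw => by
    obtain ⟨μ, hμ⟩ := hSH v.2
    exact nPlusOrbit_K q (Kinv_weight q hμ) hcE.2 hcX.2 hw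
  let T : Submodule (nMinusZ q) M := Submodule.span (nMinusZ q) (W : Set M)
  have hc : ∀ (c : ℂ) (t : M), t ∈ T → c • t ∈ T := fun c t ht => by
    have := T.smul_mem (algebraMap ℂ (nMinusZ q) c) ht
    rwa [algebraMap_smul] at this
  have hsub : ∀ s t : M, s ∈ T → t ∈ T → s - t ∈ T := fun s t hs ht => by
    rw [sub_eq_add_neg, ← neg_one_smul ℂ t]
    exact T.add_mem hs (hc _ _ ht)
  have hF : ∀ t ∈ T, u q .F • t ∈ T := fun t ht =>
    T.smul_mem (⟨u q .F, Algebra.subset_adjoin (by simp)⟩ : nMinusZ q) ht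
  have hY : ∀ t ∈ T, u q .Y • t ∈ T := fun t ht =>
    T.smul_mem (⟨u q .Y, Algebra.subset_adjoin (by simp)⟩ : nMinusZ q) ht
  have hZ : ∀ t ∈ T, u q .Z • t ∈ T := fun t ht =>
    T.smul_mem (⟨u q .Z, Algebra.subset_adjoin (by simp)⟩ : nMinusZ q) ht
  let p : M → Prop := fun t =>
    t ∈ T ∧ u q .E • t ∈ T ∧ u q .X • t ∈ T ∧ u q .K • t ∈ T ∧ u q .Kinv • t ∈ T
  have hpF : ∀ t, p t → p (u q .F • t) := by
    rintro t ⟨h0, h1, h2, h3, h4⟩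
    refine ⟨hF _ h0, ?_, ?_, ?_, ?_⟩
    · rw [← mul_smul, E_F, add_smul, smul_assoc, sub_smul, mul_smul]
      exact T.add_mem (hF _ h1) (hc _ _ (hsub _ _ h3 h4))
    · rw [← mul_smul, X_F, sub_smul, mul_smul, mul_smul]
      exact hsub _ _ (hF _ h2) (hY _ h4)
    · rw [← mul_smul, hcF.1, smul_assoc, mul_smul]
      exact hc _ _ (hF _ h3)
    · rw [← mul_smul, hcF.2, smul_assoc, mul_smul]
      exact hc _ _ (hF _ h4)
  have hpY : ∀ t, p t → p (u q .Y • t) := by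
    rintro t ⟨h0, h1, h2, h3, h4⟩
    refine ⟨hY _ h0, ?_, ?_, ?_, ?_⟩
    · rw [← mul_smul, E_Y, add_smul, smul_assoc, mul_smul]
      exact T.add_mem h2 (hc _ _ (hY _ h1))
    · rw [← mul_smul, X_Y, sub_smul, smul_assoc, mul_smul]
      exact hsub _ _ (hc _ _ (hY _ h2)) (hZ _ h0)
    · rw [← mul_smul, hcY.1, smul_assoc, mul_smul]
      exact hc _ _ (hY _ h3)
    · rw [← mul_smul, hcY.2, smul_assoc, mul_smul]
      exact hc _ _ (hY _ h4)
  have hpZ : ∀ t, p t → p (u q .Z • t) := by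
    rintro t ⟨h0, h1, h2, h3, h4⟩
    refine ⟨hZ _ h0, ?_, ?_, ?_, ?_⟩ <;>
      (rw [← mul_smul, ← Z_comm, mul_smul]; apply hZ; assumption)
  have hp0 : p 0 := by simp [p]
  have hpadd : ∀ s t, p s → p t → p (s + t) := by
    rintro s t ⟨h0, h1, h2, h3, h4⟩ ⟨k0, k1, k2, k3, k4⟩
    refine ⟨T.add_mem h0 k0, ?_, ?_, ?_, ?_⟩ <;>
      (rw [smul_add]; apply T.add_mem <;> assumption)
  have hpc : ∀ (c : ℂ) t, p t → p (c • t) := by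
    rintro c t ⟨h0, h1, h2, h3, h4⟩
    refine ⟨hc _ _ h0, ?_, ?_, ?_, ?_⟩ <;>
      (rw [smul_algebra_smul_comm]; apply hc; assumption)
  have hpS : ∀ s ∈ nMinusZ q, ∀ t, p t → p (s • t) := by
    intro s hs
    induction hs using Algebra.adjoin_induction with
    | mem x hx =>
      rcases hx with rfl | rfl | rfl
      · exact hpF
      · exact hpY
      · exact hpZ
    | algebraMap r => intro t ht; rw [algebraMap_smul]; exact hpc r t ht
    | add x y _ _ hx hy => intro t ht; rw [add_smul]; exact hpadd _ _ (hx t ht) (hy t ht)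
    | mul x y _ _ hx hy => intro t ht; rw [mul_smul]; exact hx _ (hy t ht)
  have hpT : ∀ t ∈ T, p t := by
    intro t ht
    induction ht using Submodule.span_induction with
    | mem x hx =>
      exact ⟨Submodule.subset_span hx, Submodule.subset_span (hWE x hx),
        Submodule.subset_span (hWX x hx), Submodule.subset_span (hWK x hx),
        Submodule.subset_span (hWK' x hx)⟩
    | zero => exact hp0
    | add x y _ _ hx hy => exact hpadd x y hx hy
    | smul a x _ hx => exact hpS a a.2 x hx
  have hTU : ∀ a : Uq q, ∀ t ∈ T, a • t ∈ T := by
    intro a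
    have ha : a ∈ Algebra.adjoin ℂ (Set.range (u q)) := by rw [adjoin_range_u]; trivial
    induction ha using Algebra.adjoin_induction with
    | mem x hx =>
      obtain ⟨g, rfl⟩ := hx
      intro t ht
      obtain ⟨h0, h1, h2, h3, h4⟩ := hpT t ht
      cases g
      · exact h1
      · exact hF t ht
      · exact h3
      · exact h4
      · exact h2
      · exact hY t ht
      · exact hZ t ht
    | algebraMap r => intro t ht; rw [algebraMap_smul]; exact hc r t ht
    | add x y _ _ hx hy => intro t ht; rw [add_smul]; exact T.add_mem (hx t ht) (hy t ht)
    | mul x y _ _ hx hy => intro t ht; rw [mul_smul]; exact hx _ (hy t ht)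
  let T' : Submodule (Uq q) M := { T with smul_mem' := fun a t ht => hTU a t ht }
  have hT' : T' = ⊤ := by
    rw [eq_top_iff, hS, Submodule.span_le]
    intro v hv
    exact Submodule.subset_span
      (Submodule.mem_iSup_of_mem (p := fun v : S => nPlusOrbit q (v : M)) ⟨v, hv⟩
        (mem_nPlusOrbit q v))
  have hT : T = ⊤ := by
    rw [eq_top_iff]
    intro v _
    have : v ∈ T' := by rw [hT']; trivial
    exact this
  obtain ⟨B, hB⟩ : W.FG := Module.Finite.iff_fg.mp inferInstance
  refine ⟨⟨B, ?_⟩⟩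
  rw [eq_top_iff, ← hT, Submodule.span_le]
  intro w hw
  have hw' : w ∈ Submodule.span ℂ (B : Set M) := by rw [hB]; exact hw
  exact Submodule.span_le_restrictScalars ℂ (nMinusZ q) _ hw'

end Noetherian

section Closure

variable (q : ℂˣ) {M N : Type} [AddCommGroup M] [Module ℂ M] [Module (Uq q) M]
  [IsScalarTower ℂ (Uq q) M] [AddCommGroup N] [Module ℂ N] [Module (Uq q) N]
  [IsScalarTower ℂ (Uq q) N]

/-- `M` is of type `1` if and only if it is spanned by its weight spaces for powers of `q`. -/
lemma isTypeOne_iff : IsTypeOne q M ↔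
    ⨆ μ ∈ Set.range (fun n : ℤ => q ^ n), weightSpace q M μ = ⊤ := by
  constructor
  · rintro ⟨h1, h2⟩
    rw [eq_top_iff, ← (h1 : ⨆ μ : ℂˣ, weightSpace q M μ = ⊤)]
    refine iSup_le fun μ => ?_
    by_cases hμ : weightSpace q M μ = ⊥
    · simp [hμ]
    · exact le_iSup₂_of_le μ (h2 hμ) le_rfl
  · intro h
    refine ⟨?_, fun μ hμ => ?_⟩
    · rw [IsWeight, eq_top_iff, ← h]
      exact iSup₂_le fun μ _ => le_iSup (weightSpace q M) μ
    · by_contra hn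
      apply hμ
      have hi := Module.End.eigenspaces_iSupIndep (Algebra.lsmul ℂ ℂ M (u q .K)) (μ : ℂ)
      refine disjoint_self.mp (Disjoint.mono_right ?_ hi)
      refine le_top.trans (h.symm.le.trans ?_)
      refine iSup₂_le fun ν hν => ?_
      refine le_iSup₂_of_le (ν : ℂ) ?_ le_rfl
      rintro hh
      exact hn (Units.ext hh ▸ hν)

lemma map_weightSpace (f : M →ₗ[Uq q] N) {μ : ℂˣ} {v : M} (hv : v ∈ weightSpace q M μ) :
    f v ∈ weightSpace q N μ := by
  rw [mem_weightSpace] at hv ⊢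
  rw [← map_smul, hv]
  exact (f.restrictScalars ℂ).map_smul _ _

lemma mem_of_map_mem (f : M →ₗ[Uq q] N) (hf : Function.Injective f) (S : Finset ℂˣ) :
    ∀ v : M, f v ∈ ⨆ μ ∈ S, weightSpace q N μ → v ∈ ⨆ μ ∈ S, weightSpace q M μ := by
  classical
  induction S using Finset.induction_on with
  | empty =>
    intro v hv
    have : f v = 0 := by simpa using hv
    have : v = 0 := hf (by rw [this, map_zero])
    simp [this]
  | insert ν S hν ih =>
    intro v hv
    -- `K - ν` kills the `ν`-component and preserves the other ones
    rw [Finset.iSup_insert] at hv ⊢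
    obtain ⟨a, ha, b, hb, hab⟩ := Submodule.mem_sup.mp hv
    have hb' : u q .K • b - (ν : ℂ) • b ∈ ⨆ μ ∈ S, weightSpace q N μ := by
      have hle : ⨆ μ ∈ S, weightSpace q N μ ≤ (⨆ μ ∈ S, weightSpace q N μ).comap
          (Algebra.lsmul ℂ ℂ N (u q .K) - (ν : ℂ) • LinearMap.id) := by
        refine iSup₂_le fun μ hμ x hx => ?_
        have h1 := (mem_weightSpace q).mp hx
        have h2 : (Algebra.lsmul ℂ ℂ N (u q .K) - (ν : ℂ) • LinearMap.id : N →ₗ[ℂ] N) x =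
            ((μ : ℂ) - ν) • x := by
          simp [h1, sub_smul]
        rw [Submodule.mem_comap, h2]
        exact Submodule.smul_mem _ _ (Submodule.mem_iSup_of_mem μ
          (Submodule.mem_iSup_of_mem hμ hx))
      simpa using hle hb
    have hw : u q .K • v - (ν : ℂ) • v ∈ ⨆ μ ∈ S, weightSpace q M μ := by
      apply ih
      have h1 : f ((ν : ℂ) • v) = (ν : ℂ) • f v := (f.restrictScalars ℂ).map_smul _ _
      rw [map_sub, map_smul, h1, ← hab, smul_add, (mem_weightSpace q).mp ha, smul_add]
      simpa using hb'
    -- `K - ν` is onto on the sum of the other components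
    have honto : ∀ w ∈ ⨆ μ ∈ S, weightSpace q M μ, ∃ w' ∈ ⨆ μ ∈ S, weightSpace q M μ,
        u q .K • w' - (ν : ℂ) • w' = w := by
      have hle : ⨆ μ ∈ S, weightSpace q M μ ≤ (⨆ μ ∈ S, weightSpace q M μ).map
          (Algebra.lsmul ℂ ℂ M (u q .K) - (ν : ℂ) • LinearMap.id) := by
        refine iSup₂_le fun μ hμ x hx => ?_
        have h1 := (mem_weightSpace q).mp hx
        have hne : (μ : ℂ) - ν ≠ 0 := by
          rw [sub_ne_zero]
          intro h
          exact hν (Units.ext h ▸ hμ)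
        refine ⟨((μ : ℂ) - ν)⁻¹ • x, Submodule.smul_mem _ _ (Submodule.mem_iSup_of_mem μ
          (Submodule.mem_iSup_of_mem hμ hx)), ?_⟩
        have h2 : (Algebra.lsmul ℂ ℂ M (u q .K) - (ν : ℂ) • LinearMap.id : M →ₗ[ℂ] M) x =
            ((μ : ℂ) - ν) • x := by
          simp [h1, sub_smul]
        rw [map_smul, h2, smul_smul, inv_mul_cancel₀ hne, one_smul]
      intro w hw
      obtain ⟨w', hw', h⟩ := hle hw
      exact ⟨w', hw', by simpa using h⟩
    obtain ⟨w', hw', h⟩ := honto _ hw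
    refine Submodule.mem_sup.mpr ⟨v - w', ?_, w', hw', by abel⟩
    rw [mem_weightSpace, smul_sub, smul_sub, sub_eq_sub_iff_sub_eq_sub]
    exact h.symm

lemma IsWeight.of_injective (f : M →ₗ[Uq q] N) (hf : Function.Injective f)
    (h : IsWeight q N) : IsWeight q M := by
  classical
  rw [IsWeight, eq_top_iff]
  rintro v -
  have hv : f v ∈ ⨆ μ : ℂˣ, weightSpace q N μ := by
    rw [(h : ⨆ μ : ℂˣ, weightSpace q N μ = ⊤)]; trivial
  obtain ⟨S, hS⟩ := Submodule.mem_iSup_iff_exists_finset.mp hv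
  exact (iSup₂_le fun μ _ => le_iSup (weightSpace q M) μ :
    ⨆ μ ∈ S, weightSpace q M μ ≤ _) (mem_of_map_mem q f hf S v hS)

lemma IsTypeOne.of_injective (f : M →ₗ[Uq q] N) (hf : Function.Injective f)
    (h : IsTypeOne q N) : IsTypeOne q M := by
  refine ⟨h.1.of_injective q f hf, fun μ hμ => h.2 ?_⟩
  obtain ⟨v, hv, hv0⟩ := (Submodule.ne_bot_iff _).mp hμ
  exact (Submodule.ne_bot_iff _).mpr ⟨f v, map_weightSpace q f hv,
    fun h0 => hv0 (hf (by rw [h0, map_zero]))⟩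

lemma nPlusOrbit_map (f : M →ₗ[Uq q] N) (v : M) :
    nPlusOrbit q (f v) = (nPlusOrbit q v).map (f.restrictScalars ℂ) := by
  ext w
  simp [nPlusOrbit]

lemma IsCategoryA.of_injective (f : M →ₗ[Uq q] N) (hf : Function.Injective f)
    (h : IsCategoryA q N) : IsCategoryA q M where
  finite := have := h.finite; FiniteDimensional.of_injective (f.restrictScalars ℂ) hf
  typeOne := h.typeOne.of_injective q f hf
  zero v := hf (by rw [map_smul, h.zero, map_zero])

lemma IsCategoryO0.of_injective (f : M →ₗ[Uq q] N) (hf : Function.Injective f)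
    (h : IsCategoryO0 q N) : IsCategoryO0 q M := by
  refine ⟨⟨?_, h.1.weight.of_injective q f hf, fun v => ?_⟩, fun v => ?_⟩
  · have := isNoetherianRing_nMinusZ q
    have := h.1.finite_nMinusZ q
    let f' : M →ₗ[nMinusZ q] N :=
      { toFun := f, map_add' := f.map_add, map_smul' := fun a x => f.map_smul (a : Uq q) x }
    obtain ⟨B, hB⟩ := (Module.Finite.of_injective f' hf).fg_top
    refine ⟨⟨B, ?_⟩⟩
    rw [eq_top_iff]
    intro v _
    have hv : v ∈ Submodule.span (nMinusZ q) (B : Set M) := by rw [hB]; trivial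
    exact Submodule.span_le_restrictScalars (nMinusZ q) (Uq q) _ hv
  · have := h.1.locallyFinite (f v)
    rw [nPlusOrbit_map] at this
    exact Module.Finite.equiv (Submodule.equivMapOfInjective (f.restrictScalars ℂ) hf _).symm
  · obtain ⟨n, hn⟩ := h.2 (f v)
    exact ⟨n, hf (by rw [map_smul, hn, map_zero])⟩

variable {L : Type} [AddCommGroup L] [Module ℂ L] [Module (Uq q) L] [IsScalarTower ℂ (Uq q) L]

lemma weight_join (f : M →ₗ[Uq q] L) (g : N →ₗ[Uq q] L) (hfg : ∀ x, ∃ a b, f a + g b = x)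
    (Λ : Set ℂˣ) (hM : ⨆ μ ∈ Λ, weightSpace q M μ = ⊤) (hN : ⨆ μ ∈ Λ, weightSpace q N μ = ⊤) :
    ⨆ μ ∈ Λ, weightSpace q L μ = ⊤ := by
  have h1 : (⊤ : Submodule ℂ M) ≤ (⨆ μ ∈ Λ, weightSpace q L μ).comap (f.restrictScalars ℂ) := by
    rw [← hM]
    exact iSup₂_le fun μ hμ x hx => Submodule.mem_iSup_of_mem μ
      (Submodule.mem_iSup_of_mem hμ (map_weightSpace q f hx))
  have h2 : (⊤ : Submodule ℂ N) ≤ (⨆ μ ∈ Λ, weightSpace q L μ).comap (g.restrictScalars ℂ) := by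
    rw [← hN]
    exact iSup₂_le fun μ hμ x hx => Submodule.mem_iSup_of_mem μ
      (Submodule.mem_iSup_of_mem hμ (map_weightSpace q g hx))
  rw [eq_top_iff]
  intro x _
  obtain ⟨a, b, rfl⟩ := hfg x
  exact Submodule.add_mem _ (h1 (Submodule.mem_top (x := a))) (h2 (Submodule.mem_top (x := b)))

lemma IsCategoryA.join (f : M →ₗ[Uq q] L) (g : N →ₗ[Uq q] L)
    (hfg : ∀ x, ∃ a b, f a + g b = x) (hM : IsCategoryA q M) (hN : IsCategoryA q N) :
    IsCategoryA q L where
  finite := by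
    have := hM.finite
    have := hN.finite
    refine Module.Finite.of_surjective
      ((f.restrictScalars ℂ).coprod (g.restrictScalars ℂ)) fun x => ?_
    obtain ⟨a, b, h⟩ := hfg x
    exact ⟨(a, b), by simpa using h⟩
  typeOne := (isTypeOne_iff q).mpr (weight_join q f g hfg _ ((isTypeOne_iff q).mp hM.typeOne)
    ((isTypeOne_iff q).mp hN.typeOne))
  zero x := by
    obtain ⟨a, b, rfl⟩ := hfg x
    rw [smul_add, ← map_smul, ← map_smul, hM.zero, hN.zero, map_zero, map_zero, add_zero]

lemma IsCategoryO0.join (f : M →ₗ[Uq q] L) (g : N →ₗ[Uq q] L)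
    (hfg : ∀ x, ∃ a b, f a + g b = x) (hM : IsCategoryO0 q M) (hN : IsCategoryO0 q N) :
    IsCategoryO0 q L := by
  refine ⟨⟨?_, ?_, fun x => ?_⟩, fun x => ?_⟩
  · have := hM.1.finite
    have := hN.1.finite
    refine Module.Finite.of_surjective (f.coprod g) fun x => ?_
    obtain ⟨a, b, h⟩ := hfg x
    exact ⟨(a, b), by simpa using h⟩
  · have := weight_join q f g hfg Set.univ (by simpa [IsWeight] using hM.1.weight)
      (by simpa [IsWeight] using hN.1.weight)
    simpa [IsWeight] using this
  · obtain ⟨a, b, rfl⟩ := hfg x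
    have := hM.1.locallyFinite a
    have := hN.1.locallyFinite b
    have hle : nPlusOrbit q (f a + g b) ≤ nPlusOrbit q (f a) ⊔ nPlusOrbit q (g b) := by
      rintro _ ⟨c, hc, rfl⟩
      exact Submodule.mem_sup.mpr ⟨c • f a, ⟨c, hc, rfl⟩, c • g b, ⟨c, hc, rfl⟩, by simp⟩
    rw [nPlusOrbit_map, nPlusOrbit_map] at hle
    exact Submodule.finiteDimensional_of_le hle
  · obtain ⟨a, b, rfl⟩ := hfg x
    obtain ⟨m, hm⟩ := hM.2 a
    obtain ⟨n, hn⟩ := hN.2 b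
    refine ⟨m + n, ?_⟩
    have h1 : u q .Z ^ (m + n) • a = 0 := by rw [add_comm, pow_add, mul_smul, hm, smul_zero]
    have h2 : u q .Z ^ (m + n) • b = 0 := by rw [pow_add, mul_smul, hn, smul_zero]
    rw [smul_add, ← map_smul, ← map_smul, h1, h2, map_zero, map_zero, add_zero]

lemma IsCategoryA.of_subsingleton [Subsingleton M] : IsCategoryA q M where
  finite := inferInstance
  typeOne := ⟨Subsingleton.elim _ _, fun _ hμ => absurd (Subsingleton.elim _ _) hμ⟩
  zero _ := Subsingleton.elim _ _

lemma IsCategoryO0.of_subsingleton [Subsingleton M] : IsCategoryO0 q M :=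
  ⟨⟨inferInstance, Subsingleton.elim _ _, fun _ => inferInstance⟩,
    fun _ => ⟨0, Subsingleton.elim _ _⟩⟩

end Closure

section Abelian

/-- Closure of a class of modules under products, from closure under submodules and sums. -/
lemma isClosedUnderFiniteProducts {R : Type} [Ring R] (P : ObjectProperty (ModuleCat.{0} R))
    [P.ContainsZero] [P.IsClosedUnderSubobjects]
    (h : ∀ A B : ModuleCat.{0} R, P A → P B → P (ModuleCat.of R (A × B))) :
    P.IsClosedUnderFiniteProducts := by
  have : P.IsClosedUnderBinaryProducts := ⟨by
    rintro X ⟨p⟩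
    let A := p.diag.obj ⟨.left⟩
    let B := p.diag.obj ⟨.right⟩
    let a : X ⟶ A := p.π.app ⟨.left⟩
    let b : X ⟶ B := p.π.app ⟨.right⟩
    let c : X ⟶ ModuleCat.of R (A × B) := ModuleCat.ofHom (a.hom.prod b.hom)
    have ha : c ≫ ModuleCat.ofHom (LinearMap.fst R A B) = a := by ext x; rfl
    have hb : c ≫ ModuleCat.ofHom (LinearMap.snd R A B) = b := by ext x; rfl
    have : Mono c := ⟨fun {Z} s t hst => by
      refine p.isLimit.hom_ext ?_
      rintro ⟨_ | _⟩
      · change s ≫ a = t ≫ a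
        rw [← ha, ← Category.assoc, hst, Category.assoc]
      · change s ≫ b = t ≫ b
        rw [← hb, ← Category.assoc, hst, Category.assoc]⟩
    exact P.prop_of_mono c (h A B (p.prop_diag_obj _) (p.prop_diag_obj _))⟩
  exact .mk'

section FD

variable (A : Type) [Ring A] [Algebra ℂ A]

open scoped ModuleCat

instance : (isFD A).ContainsZero where
  exists_zero := ⟨ModuleCat.of A PUnit, ModuleCat.isZero_of_subsingleton _,
    (inferInstance : FiniteDimensional ℂ (ModuleCat.of A PUnit))⟩

instance : (isFD A).IsClosedUnderSubobjects where
  prop_of_mono {X Y} f hf hY := by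
    have : FiniteDimensional ℂ Y := hY
    exact FiniteDimensional.of_injective (f.hom.restrictScalars ℂ)
      ((ModuleCat.mono_iff_injective f).mp hf)

instance : (isFD A).IsClosedUnderQuotients where
  prop_of_epi {X Y} f hf hX := by
    have : FiniteDimensional ℂ X := hX
    exact Module.Finite.of_surjective (f.hom.restrictScalars ℂ)
      ((ModuleCat.epi_iff_surjective f).mp hf)

instance : (isFD A).IsClosedUnderFiniteProducts :=
  isClosedUnderFiniteProducts _ fun M N hM hN => by
    have : FiniteDimensional ℂ M := hM
    have : FiniteDimensional ℂ N := hN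
    let f : M →ₗ[A] ModuleCat.of A (M × N) := LinearMap.inl A M N
    let g : N →ₗ[A] ModuleCat.of A (M × N) := LinearMap.inr A M N
    refine Module.Finite.of_surjective
      ((f.restrictScalars ℂ).coprod (g.restrictScalars ℂ)) ?_
    rintro ⟨a, b⟩
    exact ⟨(a, b), by simp [f, g]⟩

end FD

section AO

variable (q : ℂˣ)

open scoped ModuleCat

instance : (isA q).ContainsZero where
  exists_zero := ⟨ModuleCat.of (Uq q) PUnit, ModuleCat.isZero_of_subsingleton _,
    IsCategoryA.of_subsingleton q (M := ModuleCat.of (Uq q) PUnit)⟩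

instance : (isA q).IsClosedUnderSubobjects where
  prop_of_mono {_ _} f hf hY :=
    IsCategoryA.of_injective q f.hom ((ModuleCat.mono_iff_injective f).mp hf) hY

instance : (isA q).IsClosedUnderQuotients where
  prop_of_epi {_ _} f hf hX :=
    IsCategoryA.join q f.hom f.hom (fun x => by
      obtain ⟨a, ha⟩ := (ModuleCat.epi_iff_surjective f).mp hf x
      exact ⟨a, 0, by rw [map_zero, add_zero, ha]⟩) hX hX

instance : (isA q).IsClosedUnderFiniteProducts :=
  isClosedUnderFiniteProducts _ fun M N hM hN =>
    IsCategoryA.join q (L := ModuleCat.of (Uq q) (M × N))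
      (LinearMap.inl (Uq q) M N) (LinearMap.inr (Uq q) M N)
      (fun x => ⟨x.1, x.2, by simp⟩) hM hN

instance : (isO0 q).ContainsZero where
  exists_zero := ⟨ModuleCat.of (Uq q) PUnit, ModuleCat.isZero_of_subsingleton _,
    IsCategoryO0.of_subsingleton q (M := ModuleCat.of (Uq q) PUnit)⟩

instance : (isO0 q).IsClosedUnderSubobjects where
  prop_of_mono {_ _} f hf hY :=
    IsCategoryO0.of_injective q f.hom ((ModuleCat.mono_iff_injective f).mp hf) hY

instance : (isO0 q).IsClosedUnderQuotients where
  prop_of_epi {_ _} f hf hX :=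
    IsCategoryO0.join q f.hom f.hom (fun x => by
      obtain ⟨a, ha⟩ := (ModuleCat.epi_iff_surjective f).mp hf x
      exact ⟨a, 0, by rw [map_zero, add_zero, ha]⟩) hX hX

instance : (isO0 q).IsClosedUnderFiniteProducts :=
  isClosedUnderFiniteProducts _ fun M N hM hN =>
    IsCategoryO0.join q (L := ModuleCat.of (Uq q) (M × N))
      (LinearMap.inl (Uq q) M N) (LinearMap.inr (Uq q) M N)
      (fun x => ⟨x.1, x.2, by simp⟩) hM hN

end AO

end Abelian

/-- A `ℂ`-linear abelian category `C` is wild if there is an exact `ℂ`-linear functor to `C` from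
the category of finite-dimensional representations of the free associative algebra `ℂ⟨x₁, x₂⟩`
which preserves indecomposability and takes nonisomorphic modules to nonisomorphic objects. -/
def IsWild (C : Type*) [Category* C] [Abelian C] [Linear ℂ C] : Prop :=
  ∃ Φ : FDMod (FreeAlgebra ℂ (Fin 2)) ⥤ C,
    exactFunctor _ _ Φ ∧ Φ.Linear ℂ ∧
    (∀ V, Indecomposable V → Indecomposable (Φ.obj V)) ∧
    (∀ V W, IsEmpty (V ≅ W) → IsEmpty (Φ.obj V ≅ Φ.obj W))

end QuantumSchrodinger

namespace QuantumSchrodinger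

/-! Let S_n be the simple type 1 module of dimension n + 1 over the subalgebra generated by E, F and
K, realised on the monomials x^i y^j with i + j = n. The pair X, Y transforms like S_1, and S_1 ⊗
S_n = S_{n+1} ⊕ S_{n-1}. So an action of X and Y on a sum of modules S_n ⊗ N_n amounts to one
operator of degree 1 and one of degree -1 on the graded space N. After a suitable rescaling, and for
N living in positive degrees, the relation qYX = XY (that is, Z = 0) holds as soon as these two
operators commute (`opFun_XY`). Commutative grids of vector spaces thus produce modules in 𝒜.

A representation V of the free algebra is encoded in such a grid with V³ in degree 4. There the
first summand is the kernel of `raise`, the third is the kernel of `lower`, and the second is the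
intersection of the kernels of their squares. Every homomorphism is therefore diagonal on V³. The
diagonal of V³ is the image of `raise`, which makes the three diagonal entries equal. The set of all
(v, x₁v, x₂v) is the image of `lower`, which makes the common entry commute with x₁ and x₂
(`symbol_four_eq`, `residueFun_smul`).

This entry, the residue, is functorial in the homomorphism, so isomorphic images come from
isomorphic representations. An idempotent with zero residue is zero (`eq_zero_of_residue`), so
indecomposability is preserved. Fullness of the functor is not needed. Since 𝒜 lies in 𝒪[0] and in
the category of finite-dimensional modules, one functor serves all three cases. -/

/-- The free associative algebra on two generators. -/
abbrev FreeTwo : Type := FreeAlgebra ℂ (Fin 2)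

/-! ### Quantum integers at a parameter that is not a root of unity -/

section QuantumIntegers

variable (q : ℂˣ)

/-- The quantum integer `[n]`. -/
noncomputable def qint (n : ℤ) : ℂ := ((q : ℂ) - (q : ℂ)⁻¹)⁻¹ * ((q : ℂ) ^ n - (q : ℂ) ^ (-n))

@[simp] lemma qint_zero : qint q 0 = 0 := by simp [qint]

variable {q}

lemma zpow_injective (hq : ∀ n : ℕ, 0 < n → q ^ n ≠ 1) :
    Function.Injective fun n : ℤ => (q : ℂ) ^ n := by
  have h : Function.Injective fun n : ℤ => q ^ n := by
    rw [injective_zpow_iff_not_isOfFinOrder, isOfFinOrder_iff_pow_eq_one]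
    rintro ⟨n, hn, h⟩
    exact hq n hn h
  intro m n hmn
  apply h
  ext
  simpa using hmn

lemma sub_inv_ne_zero (hq : ∀ n : ℕ, 0 < n → q ^ n ≠ 1) : (q : ℂ) - (q : ℂ)⁻¹ ≠ 0 := by
  rw [sub_ne_zero]
  intro h
  have := @zpow_injective q hq 1 (-1) (by simpa using h)
  omega

lemma qint_ne_zero (hq : ∀ n : ℕ, 0 < n → q ^ n ≠ 1) {n : ℤ} (hn : n ≠ 0) : qint q n ≠ 0 := by
  refine mul_ne_zero (inv_ne_zero (sub_inv_ne_zero hq)) ?_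
  rw [sub_ne_zero]
  intro h
  have := zpow_injective hq h
  omega

/-- The source of all coefficient identities in which X or Y is moved past another generator. -/
lemma qint_add (m n : ℤ) :
    qint q (m + n) = (q : ℂ) ^ m * qint q n + (q : ℂ) ^ (-n) * qint q m := by
  have h0 : (q : ℂ) ≠ 0 := q.ne_zero
  simp only [qint, neg_add, zpow_add₀ h0]
  ring

lemma qint_one (hq : (q : ℂ) - (q : ℂ)⁻¹ ≠ 0) : qint q 1 = 1 := by
  simp [qint, hq]

lemma qint_neg (n : ℤ) : qint q (-n) = -qint q n := by
  simp only [qint, neg_neg]; ring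

end QuantumIntegers

/-! ### The grid: two commuting graded operators encoding a representation -/

/-- The vertices of the grid representation, a commutative diagram of shape
```
c2 → k1
↑    ↑
c1 → l1, l2
↑    ↑
c0 → u1, u2, u3 → r2, r3 → s3
     ↑            ↑        ↑
     e1 ────────→ e2 ────→ e3
```
where the letters `u`, `l`, `k`, `r`, `s` name the components of powers of `V`. -/
inductive Vtx : Type
  | c0 | c1 | c2 | u1 | u2 | u3 | e1 | e2 | e3 | r2 | r3 | s3 | l1 | l2 | k1
  deriving DecidableEq

instance : Fintype Vtx where
  elems := {.c0, .c1, .c2, .u1, .u2, .u3, .e1, .e2, .e3, .r2, .r3, .s3, .l1, .l2, .k1}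
  complete k := by cases k <;> decide

/-- The degree of a vertex. -/
def Vtx.deg : Vtx → ℤ
  | c2 => 1
  | c1 | k1 => 2
  | c0 | l1 | l2 => 3
  | u1 | u2 | u3 => 4
  | e1 | r2 | r3 => 5
  | e2 | s3 => 6
  | e3 => 7

section Grid

variable {V : Type} [AddCommGroup V] [Module ℂ V] [Module FreeTwo V] [IsScalarTower ℂ FreeTwo V]

variable (V) in
/-- The operator of degree `1` on the grid representation attached to `V`. -/
def raise : (Vtx → V) →ₗ[ℂ] (Vtx → V) where
  toFun p
    | .u1 => p .c0
    | .u2 => p .c0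
    | .u3 => p .c0
    | .l1 => p .c1
    | .l2 => p .c1
    | .k1 => p .c2
    | .r2 => p .u2
    | .r3 => p .u3
    | .s3 => p .r3
    | .e2 => p .e1
    | .e3 => p .e2
    | .c0 => 0
    | .c1 => 0
    | .c2 => 0
    | .e1 => 0
  map_add' p p' := by ext k; cases k <;> simp
  map_smul' c p := by ext k; cases k <;> simp

variable (V) in
/-- The operator of degree `-1` on the grid representation attached to `V`. -/
def lower : (Vtx → V) →ₗ[ℂ] (Vtx → V) where
  toFun p
    | .c1 => p .c0
    | .c2 => p .c1
    | .u1 => p .e1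
    | .u2 => FreeAlgebra.ι ℂ (0 : Fin 2) • p .e1
    | .u3 => FreeAlgebra.ι ℂ (1 : Fin 2) • p .e1
    | .r2 => FreeAlgebra.ι ℂ (0 : Fin 2) • p .e2
    | .r3 => FreeAlgebra.ι ℂ (1 : Fin 2) • p .e2
    | .s3 => FreeAlgebra.ι ℂ (1 : Fin 2) • p .e3
    | .l1 => p .u1
    | .l2 => p .u2
    | .k1 => p .l1
    | .c0 => 0
    | .e1 => 0
    | .e2 => 0
    | .e3 => 0
  map_add' p p' := by ext k; cases k <;> simp
  map_smul' c p := by ext k; cases k <;> simp [smul_algebra_smul_comm]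

/-- The tails `c1`, `c2` and `e2`, `e3` exist for this: as `lower (raise p)` is nonzero on `c0`, the
operator `lower` cannot kill `c0`, and dually `raise` cannot kill `e1`. -/
lemma lower_raise (p : Vtx → V) : lower V (raise V p) = raise V (lower V p) := by
  ext k; cases k <;> simp [lower, raise]

variable (V) in
/-- The component of degree `n` of the grid representation. -/
def degree (n : ℤ) : Submodule ℂ (Vtx → V) where
  carrier := {p | ∀ k : Vtx, k.deg ≠ n → p k = 0}
  add_mem' h h' k hk := by simp [h k hk, h' k hk]
  zero_mem' _ _ := rfl
  smul_mem' c p h k hk := by simp [h k hk]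

omit [Module FreeTwo V] [IsScalarTower ℂ FreeTwo V] in
lemma raise_mem {n : ℤ} {p : Vtx → V} (hp : p ∈ degree V n) : raise V p ∈ degree V (n + 1) := by
  intro k hk
  cases k <;> simp only [raise, LinearMap.coe_mk, AddHom.coe_mk] <;>
    exact hp _ (by simp only [Vtx.deg] at hk ⊢; omega)

lemma lower_mem {n : ℤ} {p : Vtx → V} (hp : p ∈ degree V n) : lower V p ∈ degree V (n - 1) := by
  intro k hk
  cases k <;> simp only [lower, LinearMap.coe_mk, AddHom.coe_mk] <;>
    first
    | exact hp _ (by simp only [Vtx.deg] at hk ⊢; omega)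
    | rw [hp _ (by simp only [Vtx.deg] at hk ⊢; omega), smul_zero]

omit [Module FreeTwo V] [IsScalarTower ℂ FreeTwo V] in
lemma eq_zero_of_mem_degree {n : ℤ} {p : Vtx → V} (hp : p ∈ degree V n) (hn : n ≤ 0 ∨ 8 ≤ n) :
    p = 0 := by
  ext k
  refine hp k ?_
  cases k <;> simp only [Vtx.deg] <;> omega

variable (V) in
/-- The space of the `U_q(𝔰)`-module attached to `V`: functions on the plane whose value at
`(i, j)` has degree `i + j`, supported in the first quadrant. -/
def total : Submodule ℂ (ℤ → ℤ → Vtx → V) where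
  carrier := {f | ∀ i j, f i j ∈ degree V (i + j) ∧ (i < 0 ∨ j < 0 → f i j = 0)}
  add_mem' h h' i j := ⟨add_mem (h i j).1 (h' i j).1, fun hij => by
    simp [(h i j).2 hij, (h' i j).2 hij]⟩
  zero_mem' i j := ⟨zero_mem _, fun _ => rfl⟩
  smul_mem' c f h i j := ⟨Submodule.smul_mem _ c (h i j).1, fun hij => by simp [(h i j).2 hij]⟩

omit [Module FreeTwo V] [IsScalarTower ℂ FreeTwo V] in
lemma eq_zero_of_add_le {f : ℤ → ℤ → Vtx → V} (hf : f ∈ total V) {i j : ℤ}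
    (h : i < 0 ∨ j < 0 ∨ i + j ≤ 0 ∨ 8 ≤ i + j) : f i j = 0 := by
  rcases h with h | h | h
  · exact (hf i j).2 (.inl h)
  · exact (hf i j).2 (.inr h)
  · exact eq_zero_of_mem_degree (hf i j).1 h

end Grid

/-! ### The generators as operators on polynomials with grid coefficients -/

section Action

variable (q : ℂˣ) (V : Type) [AddCommGroup V] [Module ℂ V] [Module FreeTwo V]
  [IsScalarTower ℂ FreeTwo V]

/-- The scalar by which the lowering operator on degree `n` is normalized. -/
noncomputable def lowerScalar (n : ℤ) : ℂ := (qint q n)⁻¹ * (qint q (n + 1))⁻¹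

/-- The operators by which the generators act on functions on the plane. -/
noncomputable def opFun : Gen → (ℤ → ℤ → Vtx → V) →ₗ[ℂ] (ℤ → ℤ → Vtx → V)
  -- With `f i j` read as the coefficient of x^i y^j, E sends x^i y^j to [j] x^{i+1} y^{j-1} and F
  -- sends it to [i] x^{i-1} y^{j+1}.
  | .E =>
    { toFun f i j := qint q (j + 1) • f (i - 1) (j + 1)
      map_add' _ _ := by ext; simp
      map_smul' _ _ := by
        ext i j : 2
        simp only [Pi.smul_apply, RingHom.id_apply]
        module }
  | .F =>
    { toFun f i j := qint q (i + 1) • f (i + 1) (j - 1)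
      map_add' _ _ := by ext; simp
      map_smul' _ _ := by
        ext i j : 2
        simp only [Pi.smul_apply, RingHom.id_apply]
        module }
  | .K =>
    { toFun f i j := (q : ℂ) ^ (i - j) • f i j
      map_add' _ _ := by ext; simp
      map_smul' _ _ := by
        ext i j : 2
        simp only [Pi.smul_apply, RingHom.id_apply]
        module }
  | .Kinv =>
    { toFun f i j := (q : ℂ) ^ (j - i) • f i j
      map_add' _ _ := by ext; simp
      map_smul' _ _ := by
        ext i j : 2
        simp only [Pi.smul_apply, RingHom.id_apply]
        module }
  -- The two summands of S_1 ⊗ S_n: multiplication by a variable goes with `raise`, and a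
  -- q-derivative in the other variable goes with `lower`.
  | .X =>
    { toFun f i j := (q : ℂ) ^ j • raise V (f (i - 1) j) -
        ((q : ℂ) ^ (-i - 1) * qint q (j + 1) * lowerScalar q (i + j + 1)) • lower V (f i (j + 1))
      map_add' _ _ := by ext; simp; abel
      map_smul' _ _ := by
        ext i j : 2
        simp only [Pi.smul_apply, map_smul, RingHom.id_apply]
        module }
  | .Y =>
    { toFun f i j := raise V (f i (j - 1)) +
        (qint q (i + 1) * lowerScalar q (i + j + 1)) • lower V (f (i + 1) j)
      map_add' _ _ := by ext; simp; abel
      map_smul' _ _ := by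
        ext i j : 2
        simp only [Pi.smul_apply, map_smul, RingHom.id_apply]
        module }
  | .Z => 0

variable {V}

lemma opFun_mem (g : Gen) {f : ℤ → ℤ → Vtx → V} (hf : f ∈ total V) : opFun q V g f ∈ total V := by
  intro i j
  cases g with
  | E =>
    refine ⟨Submodule.smul_mem _ _ ?_, fun h => ?_⟩
    · simpa using (hf (i - 1) (j + 1)).1
    · change qint q (j + 1) • f (i - 1) (j + 1) = 0
      -- Only from the row 0 could the support leak out of the quadrant, and there the coefficient
      -- [j + 1] vanishes. The other generators are treated alike.
      by_cases hj : j + 1 = 0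
      · simp [hj]
      · rw [(hf _ _).2 (by omega), smul_zero]
  | F =>
    refine ⟨Submodule.smul_mem _ _ ?_, fun h => ?_⟩
    · simpa using (hf (i + 1) (j - 1)).1
    · change qint q (i + 1) • f (i + 1) (j - 1) = 0
      by_cases hi : i + 1 = 0
      · simp [hi]
      · rw [(hf _ _).2 (by omega), smul_zero]
  | K => exact ⟨Submodule.smul_mem _ _ (hf i j).1, fun h => by simp [opFun, (hf i j).2 h]⟩
  | Kinv => exact ⟨Submodule.smul_mem _ _ (hf i j).1, fun h => by simp [opFun, (hf i j).2 h]⟩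
  | X =>
    refine ⟨sub_mem (Submodule.smul_mem _ _ ?_) (Submodule.smul_mem _ _ ?_), fun h => ?_⟩
    · convert raise_mem (hf (i - 1) j).1 using 2; ring
    · convert lower_mem (hf i (j + 1)).1 using 2; ring
    · change _ • raise V (f (i - 1) j) - _ • lower V (f i (j + 1)) = 0
      rw [(hf (i - 1) j).2 (by omega)]
      by_cases hj : j + 1 = 0
      · simp [hj]
      · rw [(hf _ _).2 (by omega)]
        simp
  | Y =>
    refine ⟨add_mem ?_ (Submodule.smul_mem _ _ ?_), fun h => ?_⟩
    · convert raise_mem (hf i (j - 1)).1 using 2; ring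
    · convert lower_mem (hf (i + 1) j).1 using 2; ring
    · change raise V (f i (j - 1)) + _ • lower V (f (i + 1) j) = 0
      rw [(hf i (j - 1)).2 (by omega)]
      by_cases hi : i + 1 = 0
      · simp [hi]
      · rw [(hf _ _).2 (by omega)]
        simp
  | Z => exact ⟨zero_mem _, fun _ => rfl⟩

variable (V) in
/-- The operators by which the generators act on `total V`. -/
noncomputable def op (g : Gen) : Module.End ℂ (total V) :=
  (opFun q V g).restrict fun _ hf => opFun_mem q g hf

end Action

/-! ### The defining relations -/

section Relations

variable (q : ℂˣ) {V : Type} [AddCommGroup V] [Module ℂ V] [Module FreeTwo V]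
  [IsScalarTower ℂ FreeTwo V] (f : ℤ → ℤ → Vtx → V) (i j : ℤ)

lemma opFun_E : opFun q V .E f i j = qint q (j + 1) • f (i - 1) (j + 1) := rfl

lemma opFun_F : opFun q V .F f i j = qint q (i + 1) • f (i + 1) (j - 1) := rfl

lemma opFun_K : opFun q V .K f i j = (q : ℂ) ^ (i - j) • f i j := rfl

lemma opFun_Kinv : opFun q V .Kinv f i j = (q : ℂ) ^ (j - i) • f i j := rfl

lemma opFun_X : opFun q V .X f i j = (q : ℂ) ^ j • raise V (f (i - 1) j) -
    ((q : ℂ) ^ (-i - 1) * qint q (j + 1) * lowerScalar q (i + j + 1)) •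
      lower V (f i (j + 1)) := rfl

lemma opFun_Y : opFun q V .Y f i j = raise V (f i (j - 1)) +
    (qint q (i + 1) * lowerScalar q (i + j + 1)) • lower V (f (i + 1) j) := rfl

lemma opFun_Z : opFun q V .Z f i j = 0 := rfl

variable {f} {q}

lemma opFun_EF (hq : (q : ℂ) - (q : ℂ)⁻¹ ≠ 0) :
    opFun q V .E (opFun q V .F f) i j - opFun q V .F (opFun q V .E f) i j =
      ((q : ℂ) - (q : ℂ)⁻¹)⁻¹ • (opFun q V .K f i j - opFun q V .Kinv f i j) := by
  have h0 : (q : ℂ) ≠ 0 := q.ne_zero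
  have h : qint q (j + 1) * qint q i - qint q (i + 1) * qint q j =
      ((q : ℂ) - (q : ℂ)⁻¹)⁻¹ * ((q : ℂ) ^ (i - j) - (q : ℂ) ^ (j - i)) := by
    have hc := inv_mul_cancel₀ hq
    simp only [qint, neg_add, zpow_add₀ h0, sub_eq_add_neg i, sub_eq_add_neg j, zpow_one,
      zpow_neg_one]
    linear_combination ((q : ℂ) - (q : ℂ)⁻¹)⁻¹ *
      ((q : ℂ) ^ i * (q : ℂ) ^ (-j) - (q : ℂ) ^ j * (q : ℂ) ^ (-i)) * hc
  simp only [opFun_E, opFun_F, opFun_K, opFun_Kinv, sub_add_cancel, add_sub_cancel_right]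
  linear_combination (norm := module) h • f i j

/-- This recursion dictates the choice of `lowerScalar`. It fails for n = 0, where the left side is
1 and the right side is 0; hence the grid starts in degree 1. -/
lemma lowerScalar_succ (hq : ∀ n : ℕ, 0 < n → q ^ n ≠ 1) {n : ℤ} (hn : 0 < n) :
    lowerScalar q (n + 1) * qint q (n + 2) = lowerScalar q n * qint q n := by
  have h1 := qint_ne_zero hq (by omega : n ≠ 0)
  have h2 := qint_ne_zero hq (by omega : n + 2 ≠ 0)
  rw [lowerScalar, lowerScalar, add_assoc, show (1 : ℤ) + 1 = 2 from rfl]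
  field_simp

/-- The terms with two `raise` or two `lower` cancel by themselves. The mixed terms cancel because
`raise` and `lower` commute and are correctly normalised. -/
lemma opFun_XY (hq : ∀ n : ℕ, 0 < n → q ^ n ≠ 1) (hf : f ∈ total V) :
    (q : ℂ) • opFun q V .Y (opFun q V .X f) i j = opFun q V .X (opFun q V .Y f) i j := by
  have h0 : (q : ℂ) ≠ 0 := q.ne_zero
  have hq' := sub_inv_ne_zero hq
  have e1 : i + (j - 1) + 1 = i + j := by ring
  have e2 : i + 1 + j + 1 = i + j + 2 := by ring
  have e3 : i - 1 + j + 1 = i + j := by ring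
  have e4 : i + (j + 1) + 1 = i + j + 2 := by ring
  have s1 : (q : ℂ) * (q : ℂ) ^ (j - 1) = (q : ℂ) ^ j := by
    rw [← zpow_one_add₀ h0]; congr 1; ring
  have s2 : (q : ℂ) * (q : ℂ) ^ (-(i + 1) - 1) = (q : ℂ) ^ (-i - 1) := by
    rw [← zpow_one_add₀ h0]; congr 1; ring
  simp only [opFun_X, opFun_Y, sub_add_cancel, add_sub_cancel_right, map_add, map_sub, map_smul,
    lower_raise, e1, e2, e3, e4]
  -- In degrees at most 0 the mixed terms vanish with `f i j`, so the recursion for `lowerScalar` is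
  -- not needed there.
  by_cases hn : i + j ≤ 0
  · rw [eq_zero_of_add_le hf (by omega : i < 0 ∨ j < 0 ∨ i + j ≤ 0 ∨ 8 ≤ i + j)]
    simp only [map_zero, smul_zero, sub_zero, add_zero, zero_sub]
    linear_combination (norm := module) s1 • raise V (raise V (f (i - 1) (j - 1))) -
      (qint q (i + 1) * lowerScalar q (i + j + 1) * qint q (j + 1) * lowerScalar q (i + j + 2)) •
        s2 • lower V (lower V (f (i + 1) (j + 1)))
  -- By the addition formula the two brackets are [i + j + 2] and [i + j], which turns this into
  -- `lowerScalar_succ`.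
  · have s3 : lowerScalar q (i + j + 1) *
        ((q : ℂ) ^ (j + 1) * qint q (i + 1) + (q : ℂ) ^ (-i - 1) * qint q (j + 1)) =
        lowerScalar q (i + j) * ((q : ℂ) ^ j * qint q i + (q : ℂ) ^ (-i) * qint q j) := by
      rw [← neg_add', ← qint_add, ← qint_add, add_comm j i, mul_comm,
        show j + 1 + (i + 1) = i + j + 2 by ring, mul_comm, lowerScalar_succ hq (by omega)]
    have s4 : (q : ℂ) * (q : ℂ) ^ (-i - 1) = (q : ℂ) ^ (-i) := by
      rw [← zpow_one_add₀ h0]; congr 1; ring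
    rw [zpow_add_one₀ h0] at s3
    linear_combination (norm := module) s1 • raise V (raise V (f (i - 1) (j - 1))) -
      (qint q (i + 1) * lowerScalar q (i + j + 1) * qint q (j + 1) * lowerScalar q (i + j + 2)) •
        s2 • lower V (lower V (f (i + 1) (j + 1))) + s3 • raise V (lower V (f i j)) -
      (qint q j * lowerScalar q (i + j)) • s4 • raise V (lower V (f i j))

end Relations

section Module

variable {q : ℂˣ} (hq : ∀ n : ℕ, 0 < n → q ^ n ≠ 1) (V : Type) [AddCommGroup V] [Module ℂ V]
  [Module FreeTwo V] [IsScalarTower ℂ FreeTwo V]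

lemma op_apply (g : Gen) (f : total V) : (op q V g f : ℤ → ℤ → Vtx → V) = opFun q V g f := rfl

include hq in
lemma op_rel {a b : FreeAlgebra ℂ Gen} (h : Rel q a b) :
    FreeAlgebra.lift ℂ (op q V) a = FreeAlgebra.lift ℂ (op q V) b := by
  have h0 : (q : ℂ) ≠ 0 := q.ne_zero
  have hq' := sub_inv_ne_zero hq
  have hadd (k m n : ℤ) (h : m + n = k) : (q : ℂ) ^ m * (q : ℂ) ^ n = (q : ℂ) ^ k := by
    rw [← zpow_add₀ h0, h]
  ext f i j : 4
  cases h <;> simp only [gen, map_mul, map_sub, map_add, map_smul, map_one,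
    FreeAlgebra.lift_ι_apply, Module.End.mul_apply, LinearMap.sub_apply, LinearMap.add_apply,
    LinearMap.smul_apply, Module.End.one_apply, op_apply, Submodule.coe_sub, Submodule.coe_add,
    Submodule.coe_smul, Pi.sub_apply, Pi.add_apply, Pi.smul_apply]
  case E_F => exact opFun_EF i j hq'
  case Y_X => rw [opFun_XY i j hq f.2, opFun_Z, sub_self]
  case K_Kinv =>
    rw [opFun_K, opFun_Kinv, smul_smul, hadd 0 _ _ (by ring), zpow_zero, one_smul]
  case Kinv_K =>
    rw [opFun_Kinv, opFun_K, smul_smul, hadd 0 _ _ (by ring), zpow_zero, one_smul]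
  case K_E =>
    simp only [opFun_K, opFun_Kinv, opFun_E]
    have := hadd 2 (i - j) (j + 1 - (i - 1)) (by ring)
    rw [zpow_ofNat] at this
    linear_combination (norm := module) (qint q (j + 1)) • this • f.1 (i - 1) (j + 1)
  case K_F =>
    simp only [opFun_K, opFun_Kinv, opFun_F]
    have := hadd (-2) (i - j) (j - 1 - (i + 1)) (by ring)
    rw [show (-2 : ℤ) = -(2 : ℕ) from rfl, zpow_neg, zpow_natCast] at this
    linear_combination (norm := module) (qint q (i + 1)) • this • f.1 (i + 1) (j - 1)
  case K_X =>
    simp only [opFun_K, opFun_Kinv, opFun_X, map_smul]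
    have h1 := hadd 1 (i - j) (j - (i - 1)) (by ring)
    have h2 := hadd 1 (i - j) (j + 1 - i) (by ring)
    rw [zpow_one] at h1 h2
    linear_combination (norm := module) ((q : ℂ) ^ j) • h1 • raise V (f.1 (i - 1) j) -
      ((q : ℂ) ^ (-i - 1) * qint q (j + 1) * lowerScalar q (i + j + 1)) • h2 •
        lower V (f.1 i (j + 1))
  case K_Y =>
    simp only [opFun_K, opFun_Kinv, opFun_Y, map_smul]
    have h1 := hadd (-1) (i - j) (j - 1 - i) (by ring)
    have h2 := hadd (-1) (i - j) (j - (i + 1)) (by ring)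
    rw [zpow_neg_one] at h1 h2
    linear_combination (norm := module) h1 • raise V (f.1 i (j - 1)) +
      (qint q (i + 1) * lowerScalar q (i + j + 1)) • h2 • lower V (f.1 (i + 1) j)
  case E_X =>
    simp only [opFun_E, opFun_X, map_smul]
    have h1 := hadd (j + 1) 1 j (by ring)
    have h2 := hadd (-(i - 1) - 1) 1 (-i - 1) (by ring)
    rw [zpow_one] at h1 h2
    rw [show i - 1 + (j + 1) + 1 = i + j + 1 by ring]
    linear_combination (norm := module) (- qint q (j + 1)) • h1 •
        raise V (f.1 (i - 1 - 1) (j + 1)) +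
      (qint q (j + 1) * qint q (j + 1 + 1) * lowerScalar q (i + j + 1)) • h2 •
        lower V (f.1 (i - 1) (j + 1 + 1))
  case E_Y =>
    simp only [opFun_E, opFun_X, opFun_Y, map_smul, sub_add_cancel, add_sub_cancel_right]
    rw [show i - 1 + (j + 1) + 1 = i + j + 1 by ring]
    -- [j + 1] = q^j + q⁻¹[j] and [i] = q⁻¹[i + 1] - q^{-i-1}: the terms q^j and -q^{-i-1} make up
    -- the summand X.
    have h1 := qint_add (q := q) j 1
    have h2 := qint_add (q := q) (-1) (i + 1)
    rw [qint_one hq', zpow_neg_one] at h1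
    rw [qint_neg, qint_one hq', zpow_neg_one, show -1 + (i + 1) = i by ring, neg_add,
      ← sub_eq_add_neg] at h2
    linear_combination (norm := module) h1 • raise V (f.1 (i - 1) j) +
      (qint q (j + 1) * lowerScalar q (i + j + 1)) • h2 • lower V (f.1 i (j + 1))
  case F_X =>
    simp only [opFun_F, opFun_X, opFun_Y, opFun_Kinv, map_smul, sub_add_cancel,
      add_sub_cancel_right]
    rw [show i + 1 + (j - 1) + 1 = i + j + 1 by ring]
    have h1 := qint_add (q := q) 1 i
    have h2 := qint_add (q := q) j 1
    have t1 := hadd j (j - 1) 1 (by ring)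
    have t2 := hadd (j - 1 - i) (j - 1) (-i) (by ring)
    have t3 := hadd (-(i + 1) - 1) (-i - 1) (-1) (by ring)
    have t4 := hadd (j - (i + 1)) (-i - 1) j (by ring)
    rw [qint_one hq', add_comm 1 i] at h1
    rw [qint_one hq'] at h2
    linear_combination (norm := module)
      ((q : ℂ) ^ (j - 1) * h1 + qint q i * t1 + t2) • raise V (f.1 i (j - 1)) +
      (qint q (i + 1) * lowerScalar q (i + j + 1)) •
        ((q : ℂ) ^ (-i - 1) * h2 + qint q j * t3 + t4) • lower V (f.1 (i + 1) j)
  case F_Y =>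
    simp only [opFun_F, opFun_Y, map_smul]
    rw [show i + 1 + (j - 1) + 1 = i + j + 1 by ring]
    module
  case Z_central g =>
    change 0 = opFun q V g 0 i j
    rw [map_zero]
    rfl

/-- The action of `U_q(𝔰)` on `total V`. -/
noncomputable def action : Uq q →ₐ[ℂ] Module.End ℂ (total V) :=
  RingQuot.liftAlgHom ℂ ⟨FreeAlgebra.lift ℂ (op q V), fun _ _ h => op_rel hq V h⟩

lemma action_u (g : Gen) : action hq V (u q g) = op q V g := by
  refine (RingQuot.liftAlgHom_mkAlgHom_apply _ _ _ _).trans ?_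
  exact FreeAlgebra.lift_ι_apply _ _

/-- The `U_q(𝔰)`-module attached to a representation `V` of the free algebra. -/
@[nolint unusedArguments]
def GridModule (_ : ∀ n : ℕ, 0 < n → q ^ n ≠ 1) (V : Type) [AddCommGroup V] [Module ℂ V]
    [Module FreeTwo V] [IsScalarTower ℂ FreeTwo V] : Type := total V

noncomputable instance : AddCommGroup (GridModule hq V) := inferInstanceAs (AddCommGroup (total V))

noncomputable instance : Module ℂ (GridModule hq V) := inferInstanceAs (Module ℂ (total V))

noncomputable instance : Module (Uq q) (GridModule hq V) :=
  Module.compHom (total V) (action hq V).toRingHom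

instance : IsScalarTower ℂ (Uq q) (GridModule hq V) where
  smul_assoc c a f := by
    exact LinearMap.congr_fun (map_smul (action hq V) c a) f

variable {V}

/-- An element of the module attached to `V`, as a function on the plane. -/
def GridModule.fn {hq : ∀ n : ℕ, 0 < n → q ^ n ≠ 1} (f : GridModule hq V) : ℤ → ℤ → Vtx → V := f.1

variable {hq}

lemma GridModule.fn_mem (f : GridModule hq V) : f.fn ∈ total V := f.2

@[ext]
lemma GridModule.ext {f g : GridModule hq V} (h : f.fn = g.fn) : f = g := Subtype.ext h

lemma GridModule.fn_u (g : Gen) (f : GridModule hq V) : (u q g • f).fn = opFun q V g (f.fn) := by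
  change ((action hq V (u q g) f : total V) : ℤ → ℤ → Vtx → V) = _
  rw [action_u]
  rfl

@[simp] lemma GridModule.fn_smul (c : ℂ) (f : GridModule hq V) : (c • f).fn = c • f.fn := rfl

@[simp] lemma GridModule.fn_zero : (0 : GridModule hq V).fn = 0 := rfl

@[simp] lemma GridModule.fn_sub (f g : GridModule hq V) : (f - g).fn = f.fn - g.fn := rfl

end Module

/-! ### Homogeneous vectors, highest weight vectors, membership in 𝒜 -/

namespace GridModule

section Single

variable {q : ℂˣ} (hq : ∀ n : ℕ, 0 < n → q ^ n ≠ 1) {V : Type} [AddCommGroup V] [Module ℂ V]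
  [Module FreeTwo V] [IsScalarTower ℂ FreeTwo V]

/-- The function on the plane supported at `(i, j)`, with value there the component of degree
`i + j` of the given one. -/
def single (i j : ℕ) : (Vtx → V) →ₗ[ℂ] GridModule hq V where
  toFun p := ⟨fun i' j' k => if i' = i ∧ j' = j ∧ k.deg = i + j then p k else 0, fun i' j' =>
    ⟨fun k hk => if_neg (by rintro ⟨rfl, rfl, h⟩; exact hk h),
      fun h => funext fun k => if_neg (by omega)⟩⟩
  map_add' p p' := by
    ext i' j' k
    change (if i' = i ∧ j' = j ∧ k.deg = (i : ℤ) + j then p k + p' k else 0) =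
      (if i' = i ∧ j' = j ∧ k.deg = (i : ℤ) + j then p k else 0) +
        (if i' = i ∧ j' = j ∧ k.deg = (i : ℤ) + j then p' k else 0)
    split_ifs <;> simp
  map_smul' c p := by
    ext i' j' k
    change (if i' = i ∧ j' = j ∧ k.deg = (i : ℤ) + j then c • p k else 0) =
      c • (if i' = i ∧ j' = j ∧ k.deg = (i : ℤ) + j then p k else 0)
    split_ifs <;> simp

variable {hq}

lemma fn_single (i j : ℕ) (p : Vtx → V) (i' j' : ℤ) (k : Vtx) : (single hq i j p).fn i' j' k =
    if i' = i ∧ j' = j ∧ k.deg = i + j then p k else 0 := rfl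

lemma fn_single_self {i j : ℕ} {p : Vtx → V} (hp : p ∈ degree V (i + j)) :
    (single hq i j p).fn i j = p := by
  ext k
  rw [fn_single]
  split_ifs with h
  · rfl
  · exact (hp k fun h' => h ⟨rfl, rfl, h'⟩).symm

lemma fn_single_of_ne {i j : ℕ} {p : Vtx → V} {i' j' : ℤ} (h : i' ≠ i ∨ j' ≠ j) :
    (single hq i j p).fn i' j' = 0 := by
  ext k
  rw [fn_single, if_neg (by omega)]
  rfl

lemma eq_single (f : GridModule hq V) (i j : ℕ)
    (h : ∀ i' j' : ℤ, i' ≠ i ∨ j' ≠ j → f.fn i' j' = 0) :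
    f = single hq i j (f.fn i j) := by
  ext i' j' : 3
  by_cases hij : i' ≠ i ∨ j' ≠ j
  · rw [h _ _ hij, fn_single_of_ne hij]
  · push Not at hij
    rw [hij.1, hij.2, fn_single_self (f.fn_mem _ _).1]

lemma single_eq_single {i j : ℕ} {p p' : Vtx → V} (h : ∀ k : Vtx, k.deg = i + j → p k = p' k) :
    single hq i j p = single hq i j p' := by
  ext i' j' k
  rw [fn_single, fn_single]
  split_ifs with hk
  · exact h k hk.2.2
  · rfl

lemma single_eq_zero {i j : ℕ} {p : Vtx → V} (h : ∀ k : Vtx, k.deg = i + j → p k = 0) :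
    single hq i j p = 0 :=
  (single_eq_single h).trans (map_zero _)

lemma fn_sum {ι : Type*} (s : Finset ι) (f : ι → GridModule hq V) (i j : ℤ) :
    (∑ t ∈ s, f t).fn i j = ∑ t ∈ s, (f t).fn i j :=
  map_sum (⟨⟨fun f => f.fn i j, rfl⟩, fun _ _ => rfl⟩ : GridModule hq V →+ (Vtx → V)) f s

/-- All degrees of the grid are at most 7, so in the first quadrant the support fits into a square
of side 8. -/
lemma sum_single (f : GridModule hq V) :
    ∑ t ∈ Finset.range 8 ×ˢ Finset.range 8, single hq t.1 t.2 (f.fn t.1 t.2) = f := by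
  ext i j : 3
  rw [fn_sum]
  by_cases h : i < 0 ∨ j < 0 ∨ i + j ≤ 0 ∨ 8 ≤ i + j
  · rw [eq_zero_of_add_le f.fn_mem h]
    refine Finset.sum_eq_zero fun t _ => ?_
    by_cases ht : i ≠ (t.1 : ℕ) ∨ j ≠ (t.2 : ℕ)
    · exact fn_single_of_ne ht
    · push Not at ht
      rw [ht.1, ht.2, fn_single_self (f.fn_mem _ _).1, ← ht.1, ← ht.2,
        eq_zero_of_add_le f.fn_mem h]
  · obtain ⟨i, rfl⟩ := Int.eq_ofNat_of_zero_le (a := i) (by omega)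
    obtain ⟨j, rfl⟩ := Int.eq_ofNat_of_zero_le (a := j) (by omega)
    rw [Finset.sum_eq_single (i, j)]
    · exact fn_single_self (f.fn_mem _ _).1
    · rintro ⟨i', j'⟩ _ ht
      refine fn_single_of_ne ?_
      rw [Ne, Prod.mk.injEq] at ht
      simp only
      omega
    · intro ht
      simp only [Finset.mem_product, Finset.mem_range] at ht
      omega

lemma K_single (i j : ℕ) (p : Vtx → V) :
    u q .K • single hq i j p = (q : ℂ) ^ (i - j : ℤ) • single hq i j p := by
  ext i' j' : 3
  rw [fn_u, opFun_K, fn_smul, Pi.smul_apply, Pi.smul_apply]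
  by_cases h : i' ≠ i ∨ j' ≠ j
  · rw [fn_single_of_ne h, smul_zero, smul_zero]
  · push Not at h
    rw [h.1, h.2]

lemma F_single (i j : ℕ) (p : Vtx → V) :
    u q .F • single hq (i + 1) j p = qint q (i + 1) • single hq i (j + 1) p := by
  ext i' j' k
  rw [fn_u, opFun_F, fn_smul]
  simp only [Pi.smul_apply, fn_single]
  by_cases h : i' = i ∧ j' = j + 1 ∧ k.deg = i + (j + 1)
  · rw [if_pos (by push_cast; omega), if_pos (by push_cast; omega), h.1]
  · rw [if_neg (by push_cast; omega), if_neg (by push_cast; omega), smul_zero, smul_zero]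

lemma E_single (n : ℕ) (p : Vtx → V) : u q .E • single hq n 0 p = 0 := by
  ext i j : 3
  rw [fn_u, opFun_E]
  by_cases hj : j + 1 = 0
  · simp [hj]
  · rw [fn_single_of_ne (by simp only [Nat.cast_zero]; omega), smul_zero]; rfl

/-- The `lower` part of X differentiates in y, hence kills a vector on the row 0. So X recovers
`raise` from the highest weight vectors. -/
lemma X_single {n : ℕ} {p : Vtx → V} (hp : p ∈ degree V n) :
    u q .X • single hq n 0 p = single hq (n + 1) 0 (raise V p) := by
  have hp' : p ∈ degree V ((n : ℤ) + (0 : ℕ)) := by simpa using hp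
  have h : ∀ i j : ℤ, (u q .X • single hq n 0 p).fn i j =
      (q : ℂ) ^ j • raise V ((single hq n 0 p).fn (i - 1) j) := by
    intro i j
    rw [fn_u, opFun_X]
    by_cases hj : j + 1 = 0
    · simp [hj]
    · rw [fn_single_of_ne (j' := j + 1) (by simp only [Nat.cast_zero]; omega)]
      simp
  rw [eq_single (u q .X • single hq n 0 p) (n + 1) 0]
  · rw [h, Nat.cast_succ, add_sub_cancel_right, fn_single_self hp']
    simp
  · intro i j hij
    rw [h, fn_single_of_ne (by omega), map_zero, smul_zero]

/-- Y yields both a `raise` and a `lower` part. The first is cancelled by FX, as F sends x^{n+2} to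
[n + 2] x^{n+1} y; the second has coefficient [n + 2][n + 1] `lowerScalar q (n + 1)` = 1. -/
lemma Y_X_single {n : ℕ} {p : Vtx → V} (hp : p ∈ degree V (n + 1)) :
    qint q (n + 2) • u q .Y • single hq (n + 1) 0 p - u q .F • u q .X • single hq (n + 1) 0 p =
      single hq n 0 (lower V p) := by
  have hp' : p ∈ degree V (((n + 1 : ℕ) : ℤ) + (0 : ℕ)) := by simpa using hp
  have hl : lower V p ∈ degree V ((n : ℤ) + (0 : ℕ)) := by simpa using lower_mem hp
  have hr : raise V p ∈ degree V (((n + 2 : ℕ) : ℤ) + (0 : ℕ)) := by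
    convert raise_mem hp using 2
    push_cast
    ring
  rw [X_single (by simpa using hp)]
  ext i j : 3
  simp only [fn_sub, fn_smul, Pi.sub_apply, Pi.smul_apply, fn_u, opFun_Y, opFun_F]
  by_cases h1 : i = n ∧ j = 0
  · obtain ⟨rfl, rfl⟩ := h1
    have e := fn_single_self (hq := hq) hp'
    have e' := fn_single_self (hq := hq) hl
    push_cast at e e'
    rw [fn_single_of_ne (i' := n) (j' := 0 - 1) (by simp),
      fn_single_of_ne (i' := n + 1) (j' := 0 - 1) (by simp), e, e']
    have h1 := qint_ne_zero hq (by omega : (n : ℤ) + 1 ≠ 0)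
    have h2 := qint_ne_zero hq (by omega : (n : ℤ) + 2 ≠ 0)
    have h : qint q (n + 2) * (qint q (n + 1) * lowerScalar q (n + 0 + 1)) = 1 := by
      rw [lowerScalar, add_zero, add_assoc, show (1 : ℤ) + 1 = 2 from rfl]
      field_simp
    rw [map_zero, zero_add, smul_smul, h, one_smul, smul_zero, sub_zero]
  · rw [fn_single_of_ne (i' := i) (j' := j) (i := n) (by push_cast; omega),
      fn_single_of_ne (i' := i + 1) (j' := j) (by push_cast; omega)]
    by_cases h2 : i = n + 1 ∧ j = 1
    · obtain ⟨rfl, rfl⟩ := h2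
      have e := fn_single_self (hq := hq) hp'
      have e' := fn_single_self (hq := hq) hr
      push_cast at e e'
      rw [show (n : ℤ) + 1 + 1 = n + 2 by ring, show (1 : ℤ) - 1 = 0 from rfl, e, e']
      simp
    · rw [fn_single_of_ne (i' := i) (j' := j - 1) (by push_cast; omega),
        fn_single_of_ne (i' := i + 1) (j' := j - 1) (by push_cast; omega)]
      simp

/-- A vector of weight `q ^ n` annihilated by `E` is supported at `(n, 0)`. -/
lemma eq_single_of_highest {f : GridModule hq V} {n : ℕ} (hK : u q .K • f = (q : ℂ) ^ (n : ℤ) • f)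
    (hE : u q .E • f = 0) : f = single hq n 0 (f.fn n 0) := by
  refine eq_single f n 0 fun i j hij => ?_
  by_cases hn : i - j = n
  -- This value is [j] times `f i j`, and on the line i - j = n the index j vanishes only at (n, 0).
  · have h : (u q .E • f).fn (i + 1) (j - 1) = 0 := by rw [hE]; rfl
    rw [fn_u, opFun_E, sub_add_cancel, add_sub_cancel_right] at h
    refine (smul_eq_zero.mp h).resolve_left (qint_ne_zero hq ?_)
    push_cast at hij
    omega
  · have h : (u q .K • f).fn i j = ((q : ℂ) ^ (n : ℤ) • f).fn i j := by rw [hK]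
    rw [fn_u, opFun_K, fn_smul, Pi.smul_apply, Pi.smul_apply, ← sub_eq_zero, ← sub_smul] at h
    refine (smul_eq_zero.mp h).resolve_left ?_
    exact fun h => hn (zpow_injective hq (sub_eq_zero.mp h))

variable (hq V) in
lemma isCategoryA [FiniteDimensional ℂ V] : IsCategoryA q (GridModule hq V) where
  finite := by
    let φ : GridModule hq V →ₗ[ℂ] (Fin 8 → Fin 8 → Vtx → V) :=
      { toFun f i j := f.fn (i : ℕ) (j : ℕ), map_add' _ _ := rfl, map_smul' _ _ := rfl }
    refine FiniteDimensional.of_injective φ fun f g h => ?_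
    rw [← sum_single f, ← sum_single g]
    refine Finset.sum_congr rfl fun t ht => ?_
    rw [Finset.mem_product, Finset.mem_range, Finset.mem_range] at ht
    have := congr_fun (congr_fun h ⟨t.1, ht.1⟩) ⟨t.2, ht.2⟩
    exact congr_arg _ this
  typeOne := by
    rw [isTypeOne_iff, eq_top_iff]
    intro f _
    rw [← sum_single f]
    refine sum_mem fun t _ => ?_
    refine Submodule.mem_iSup_of_mem (q ^ (t.1 - t.2 : ℤ)) (Submodule.mem_iSup_of_mem ⟨_, rfl⟩ ?_)
    rw [mem_weightSpace, K_single]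
    simp
  zero f := by
    ext1
    rw [fn_u]
    rfl

end Single

end GridModule

/-! ### Homomorphisms and their symbols -/

namespace GridModule

section Map

variable {q : ℂˣ} (hq : ∀ n : ℕ, 0 < n → q ^ n ≠ 1)
  {V W : Type} [AddCommGroup V] [Module ℂ V] [Module FreeTwo V] [IsScalarTower ℂ FreeTwo V]
  [AddCommGroup W] [Module ℂ W] [Module FreeTwo W] [IsScalarTower ℂ FreeTwo W]

/-- An additive map commuting with the generators is linear over `U_q(𝔰)`. -/
def linearMapOfGen {M N : Type} [AddCommGroup M] [Module ℂ M] [Module (Uq q) M]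
    [IsScalarTower ℂ (Uq q) M] [AddCommGroup N] [Module ℂ N] [Module (Uq q) N]
    [IsScalarTower ℂ (Uq q) N] (f : M →ₗ[ℂ] N) (hf : ∀ g x, f (u q g • x) = u q g • f x) :
    M →ₗ[Uq q] N where
  toFun := f
  map_add' := f.map_add
  map_smul' a x := by
    have ha : a ∈ Algebra.adjoin ℂ (Set.range (u q)) := by rw [adjoin_range_u]; trivial
    rw [RingHom.id_apply]
    induction ha using Algebra.adjoin_induction generalizing x with
    | mem a ha => obtain ⟨g, rfl⟩ := ha; exact hf g x
    | algebraMap c => rw [algebraMap_smul, algebraMap_smul, map_smul]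
    | add a b _ _ ha hb => rw [add_smul, add_smul, map_add, ha, hb]
    | mul a b _ _ ha hb => rw [mul_smul, mul_smul, ha, hb]

/-- The functoriality of the module attached to a representation of the free algebra. -/
noncomputable def map (φ : V →ₗ[FreeTwo] W) : GridModule hq V →ₗ[Uq q] GridModule hq W :=
  linearMapOfGen
    { toFun f := ⟨fun i j k => φ (f.fn i j k), fun i j =>
        ⟨fun k hk => (congr_arg φ ((f.fn_mem i j).1 k hk)).trans (map_zero φ),
          fun h => funext fun k =>
            (congr_arg φ (congr_fun ((f.fn_mem i j).2 h) k)).trans (map_zero φ)⟩⟩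
      map_add' f g := by ext i j k; exact map_add φ _ _
      map_smul' c f := by ext i j k; exact (φ.restrictScalars ℂ).map_smul _ _ }
    fun g f => by
      have hs (c : ℂ) (v : V) : φ (c • v) = c • φ v := (φ.restrictScalars ℂ).map_smul _ _
      have hr (p : Vtx → V) (k : Vtx) : raise W (fun k => φ (p k)) k = φ (raise V p k) := by
        cases k <;> simp [raise]
      have hl (p : Vtx → V) (k : Vtx) : lower W (fun k => φ (p k)) k = φ (lower V p k) := by
        cases k <;> simp [lower]
      ext i j k
      rw [fn_u]
      change φ ((u q g • f).fn i j k) = opFun q W g (fun i j k => φ (f.fn i j k)) i j k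
      rw [fn_u]
      cases g
      · simp only [opFun_E, Pi.smul_apply, hs]
      · simp only [opFun_F, Pi.smul_apply, hs]
      · simp only [opFun_K, Pi.smul_apply, hs]
      · simp only [opFun_Kinv, Pi.smul_apply, hs]
      · simp only [opFun_X, Pi.sub_apply, Pi.smul_apply, map_sub, hs, hr, hl]
      · simp only [opFun_Y, Pi.add_apply, Pi.smul_apply, map_add, hs, hr, hl]
      · simp only [opFun_Z, Pi.zero_apply, map_zero]

end Map

section Symbol

variable {q : ℂˣ} {hq : ∀ n : ℕ, 0 < n → q ^ n ≠ 1}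
  {V W U : Type} [AddCommGroup V] [Module ℂ V] [Module FreeTwo V] [IsScalarTower ℂ FreeTwo V]
  [AddCommGroup W] [Module ℂ W] [Module FreeTwo W] [IsScalarTower ℂ FreeTwo W]
  [AddCommGroup U] [Module ℂ U] [Module FreeTwo U] [IsScalarTower ℂ FreeTwo U]

lemma map_complex_smul (g : GridModule hq V →ₗ[Uq q] GridModule hq W) (c : ℂ)
    (f : GridModule hq V) : g (c • f) = c • g f :=
  (g.restrictScalars ℂ).map_smul c f

/-- The map induced by a homomorphism on highest weight vectors of weight `q ^ n`. -/
noncomputable def symbol (g : GridModule hq V →ₗ[Uq q] GridModule hq W) (n : ℕ) :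
    (Vtx → V) →ₗ[ℂ] (Vtx → W) where
  toFun p := (g (single hq n 0 p)).fn n 0
  map_add' p p' := by rw [map_add, map_add]; rfl
  map_smul' c p := by rw [map_smul, map_complex_smul]; rfl

variable (g : GridModule hq V →ₗ[Uq q] GridModule hq W)

/-- A homomorphism preserves the weight and the annihilation by E. -/
lemma map_single (n : ℕ) (p : Vtx → V) : g (single hq n 0 p) = single hq n 0 (symbol g n p) := by
  refine eq_single_of_highest ?_ ?_
  · rw [← map_smul, K_single, Nat.cast_zero, sub_zero]
    exact map_complex_smul g _ _
  · rw [← map_smul, E_single, map_zero]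

lemma symbol_mem (n : ℕ) (p : Vtx → V) : symbol g n p ∈ degree W n := by
  have h := ((g (single hq n 0 p)).fn_mem n 0).1
  rwa [add_zero] at h

lemma single_injOn {n : ℕ} {p p' : Vtx → V} (hp : p ∈ degree V n) (hp' : p' ∈ degree V n)
    (h : single hq n 0 p = single hq n 0 p') : p = p' := by
  have h1 := fn_single_self (hq := hq) (i := n) (j := 0) (by simpa using hp)
  have h2 := fn_single_self (hq := hq) (i := n) (j := 0) (by simpa using hp')
  rw [← h1, ← h2, h]

lemma symbol_raise {n : ℕ} {p : Vtx → V} (hp : p ∈ degree V n) :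
    symbol g (n + 1) (raise V p) = raise W (symbol g n p) := by
  refine single_injOn (hq := hq) (symbol_mem _ _ _)
    (by simpa using raise_mem (symbol_mem g n p)) ?_
  rw [← map_single, ← X_single hp, map_smul, map_single, X_single (symbol_mem g n p)]

/-- On highest weight vectors `lower` is given by elements of the algebra, with which g commutes.
With `symbol_raise`, this makes the symbols a morphism of grids. -/
lemma symbol_lower {n : ℕ} {p : Vtx → V} (hp : p ∈ degree V (n + 1)) :
    symbol g n (lower V p) = lower W (symbol g (n + 1) p) := by
  have h := symbol_mem g (n + 1) p
  push_cast at h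
  refine single_injOn (hq := hq) (symbol_mem _ _ _) (by simpa using lower_mem h) ?_
  rw [← map_single, ← Y_X_single hp, map_sub, map_complex_smul]
  rw [map_smul, map_smul, map_smul, map_single, Y_X_single h]

lemma symbol_id (n : ℕ) {p : Vtx → V} (hp : p ∈ degree V n) :
    symbol (LinearMap.id : GridModule hq V →ₗ[Uq q] GridModule hq V) n p = p := by
  have := fn_single_self (hq := hq) (i := n) (j := 0) (by simpa using hp)
  exact_mod_cast this

lemma symbol_comp (h : GridModule hq W →ₗ[Uq q] GridModule hq U) (n : ℕ) (p : Vtx → V) :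
    symbol (h ∘ₗ g) n p = symbol h n (symbol g n p) := by
  refine single_injOn (hq := hq) (symbol_mem _ _ _) (symbol_mem _ _ _) ?_
  rw [← map_single, LinearMap.comp_apply, map_single, map_single]

lemma symbol_eq_zero_of_degree {n : ℕ} {p : Vtx → V} (h : ∀ k : Vtx, k.deg = n → p k = 0) :
    symbol g n p = 0 := by
  change (g (single hq n 0 p)).fn n 0 = 0
  rw [single_eq_zero (by simpa using h), map_zero]
  rfl

lemma symbol_congr {n : ℕ} {p p' : Vtx → V} (h : ∀ k : Vtx, k.deg = n → p k = p' k) :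
    symbol g n p = symbol g n p' := by
  rw [← sub_eq_zero, ← map_sub]
  exact symbol_eq_zero_of_degree g fun k hk => by simp [h k hk]

-- The highest weight vectors generate: F carries (i + 1, j) to (i, j + 1) with the nonzero factor
-- [i + 1].
variable {g} in
lemma eq_zero_of_symbol (h : ∀ n p, symbol g n p = 0) : g = 0 := by
  have key : ∀ j i : ℕ, ∀ p, g (single hq i j p) = 0 := by
    intro j
    induction j with
    | zero => intro i p; rw [map_single, h, map_zero]
    | succ j ih =>
      intro i p
      have h1 : (qint q (i + 1)) • g (single hq i (j + 1) p) = 0 := by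
        have := ih (i + 1) p
        calc _ = g (qint q (i + 1) • single hq i (j + 1) p) :=
              (map_complex_smul g _ _).symm
          _ = 0 := by rw [← F_single, map_smul, ih, smul_zero]
      exact (smul_eq_zero.mp h1).resolve_left (qint_ne_zero hq (by omega))
  ext1 f
  rw [← sum_single f, map_sum]
  exact Finset.sum_eq_zero fun t _ => key _ _ _

omit [Module FreeTwo V] [IsScalarTower ℂ FreeTwo V] in
lemma single_mem (k : Vtx) {n : ℤ} (h : k.deg = n) (v : V) : Pi.single k v ∈ degree V n :=
  fun k' hk' => Pi.single_eq_of_ne (M := fun _ => V) (fun hkk' : k' = k => hk' (hkk' ▸ h)) v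

/-- The map induced by a homomorphism on the common value of the components of degree `4`. -/
noncomputable def residueFun : V →ₗ[ℂ] W :=
  LinearMap.proj .u1 ∘ₗ symbol g 4 ∘ₗ LinearMap.single ℂ (fun _ => V) .u1

lemma residueFun_apply (v : V) : residueFun g v = symbol g 4 (Pi.single .u1 v) .u1 := rfl

/-- In degree 4 the summand `u1` is the kernel of `raise`, which symbols preserve. -/
lemma symbol_u1 (v : V) : symbol g 4 (Pi.single .u1 v) .u2 = 0 ∧
    symbol g 4 (Pi.single .u1 v) .u3 = 0 := by
  have h := symbol_raise g (n := 4) (single_mem .u1 rfl v)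
  rw [show raise V (Pi.single .u1 v) = 0 by ext k; cases k <;> simp [raise], map_zero] at h
  exact ⟨(congr_fun h .r2).symm, (congr_fun h .r3).symm⟩

/-- In degree 4 the summand `u3` is the kernel of `lower`. -/
lemma symbol_u3 (v : V) : symbol g 4 (Pi.single .u3 v) .u1 = 0 ∧
    symbol g 4 (Pi.single .u3 v) .u2 = 0 := by
  have h := symbol_lower g (n := 3) (single_mem .u3 rfl v)
  rw [show lower V (Pi.single .u3 v) = 0 by ext k; cases k <;> simp [lower], map_zero] at h
  exact ⟨(congr_fun h .l1).symm, (congr_fun h .l2).symm⟩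

/-- In degree 4 the square of `lower` detects exactly `u1` and the square of `raise` exactly `u3`;
both kill `u2`. -/
lemma symbol_u2 (v : V) : symbol g 4 (Pi.single .u2 v) .u1 = 0 ∧
    symbol g 4 (Pi.single .u2 v) .u3 = 0 := by
  have hv : (Pi.single .u2 v : Vtx → V) ∈ degree V 4 := single_mem .u2 rfl v
  have h := symbol_lower g (n := 2) (p := lower V (Pi.single .u2 v)) (lower_mem hv)
  rw [symbol_lower g (n := 3) hv, show lower V (lower V (Pi.single .u2 v)) = 0 by
    ext k; cases k <;> simp [lower], map_zero] at h
  have h' := symbol_raise g (n := 5) (p := raise V (Pi.single .u2 v)) (raise_mem hv)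
  rw [symbol_raise g (n := 4) hv, show raise V (raise V (Pi.single .u2 v)) = 0 by
    ext k; cases k <;> simp [raise], map_zero] at h'
  exact ⟨(congr_fun h .k1).symm, (congr_fun h' .s3).symm⟩

lemma symbol_four (p : Vtx → V) :
    symbol g 4 p .u1 = symbol g 4 (Pi.single .u1 (p .u1)) .u1 ∧
    symbol g 4 p .u2 = symbol g 4 (Pi.single .u2 (p .u2)) .u2 ∧
    symbol g 4 p .u3 = symbol g 4 (Pi.single .u3 (p .u3)) .u3 := by
  have h : symbol g 4 p = symbol g 4 (Pi.single .u1 (p .u1)) + symbol g 4 (Pi.single .u2 (p .u2)) +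
      symbol g 4 (Pi.single .u3 (p .u3)) := by
    rw [← map_add, ← map_add]
    refine symbol_congr g fun k hk => ?_
    cases k <;> simp [Vtx.deg] at hk ⊢
  rw [h]
  simp [symbol_u1, symbol_u2, symbol_u3]

/-- The image of `raise` in degree 4 is the diagonal, coming from `c0`, and it must be mapped into
the diagonal. -/
lemma symbol_single_eq (v : V) : symbol g 4 (Pi.single .u2 v) .u2 = residueFun g v ∧
    symbol g 4 (Pi.single .u3 v) .u3 = residueFun g v := by
  have h := symbol_raise g (n := 3) (single_mem .c0 rfl v)
  have h4 := symbol_four g (raise V (Pi.single .c0 v))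
  have hv : ∀ k, k = Vtx.u1 ∨ k = .u2 ∨ k = .u3 → raise V (Pi.single .c0 v) k = v := by
    rintro k (rfl | rfl | rfl) <;> simp [raise]
  rw [hv _ (by simp), hv _ (by simp), hv _ (by simp)] at h4
  rw [residueFun_apply, ← h4.1, ← h4.2.1, ← h4.2.2]
  rw [show (4 : ℕ) = 3 + 1 from rfl, h]
  exact ⟨rfl, rfl⟩

/-- A homomorphism acts on the component of degree `4` of the grid representation diagonally. -/
lemma symbol_four_eq (p : Vtx → V) : symbol g 4 p .u1 = residueFun g (p .u1) ∧
    symbol g 4 p .u2 = residueFun g (p .u2) ∧ symbol g 4 p .u3 = residueFun g (p .u3) := by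
  have h := symbol_four g p
  rw [(symbol_single_eq g _).1, (symbol_single_eq g _).2] at h
  exact h

/-- The image of `lower` in degree 4 consists of the triples (v, x₁v, x₂v), coming from `e1`, and it
must be mapped to such triples. -/
lemma residueFun_smul (i : Fin 2) (v : V) :
    residueFun g (FreeAlgebra.ι ℂ i • v) = FreeAlgebra.ι ℂ i • residueFun g v := by
  have h := symbol_lower g (n := 4) (single_mem .e1 rfl v)
  have h4 := symbol_four_eq g (lower V (Pi.single .e1 v))
  rw [h] at h4
  have h1 : lower V (Pi.single .e1 v) .u1 = v := by simp [lower]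
  have h2 : lower V (Pi.single .e1 v) .u2 = FreeAlgebra.ι ℂ (0 : Fin 2) • v := by simp [lower]
  have h3 : lower V (Pi.single .e1 v) .u3 = FreeAlgebra.ι ℂ (1 : Fin 2) • v := by simp [lower]
  rw [h1, h2, h3] at h4
  fin_cases i
  · exact h4.2.1.symm.trans (congr_arg _ h4.1)
  · exact h4.2.2.symm.trans (congr_arg _ h4.1)

/-- The homomorphism of representations of the free algebra underlying a homomorphism between the
modules attached to them. -/
noncomputable def residue : V →ₗ[FreeTwo] W where
  toFun := residueFun g
  map_add' := map_add _
  map_smul' a v := by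
    rw [RingHom.id_apply]
    induction a using FreeAlgebra.induction generalizing v with
    | grade0 c => rw [algebraMap_smul, algebraMap_smul, map_smul]
    | grade1 i => exact residueFun_smul g i v
    | mul a b ha hb => rw [mul_smul, mul_smul, ha, hb]
    | add a b ha hb => rw [add_smul, add_smul, map_add, ha, hb]

lemma residue_apply (v : V) : residue g v = residueFun g v := rfl

lemma residue_id : residue (LinearMap.id : GridModule hq V →ₗ[Uq q] GridModule hq V) =
    LinearMap.id := by
  ext1 v
  rw [residue_apply, residueFun_apply, symbol_id 4 (single_mem .u1 rfl v)]
  simp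

lemma residue_comp (h : GridModule hq W →ₗ[Uq q] GridModule hq U) :
    residue (h ∘ₗ g) = residue h ∘ₗ residue g := by
  ext1 v
  rw [residue_apply, residueFun_apply, symbol_comp, (symbol_four_eq h _).1]
  rfl

lemma residue_sub (g' : GridModule hq V →ₗ[Uq q] GridModule hq W) :
    residue (g - g') = residue g - residue g' := by
  ext1 v
  rfl

/-- An idempotent whose residue vanishes is zero. -/
lemma eq_zero_of_residue {e : GridModule hq V →ₗ[Uq q] GridModule hq V} (he : e ∘ₗ e = e)
    (h : residue e = 0) : e = 0 := by
  have hr (v : V) : residueFun e v = 0 := LinearMap.congr_fun h v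
  -- In degrees 3 and 5 a zero residue gives directly only that the symbol has square zero;
  -- idempotency does the rest.
  have hidem (n : ℕ) (h : ∀ p ∈ degree V n, symbol e n (symbol e n p) = 0) (p) :
      symbol e n p = 0 := by
    have h1 (p) : symbol e n (symbol e n p) = symbol e n p := by rw [← symbol_comp, he]
    rw [← h1, ← h1 p]
    exact h _ (symbol_mem e n p)
  have h4 (p) : symbol e 4 p = 0 := by
    have h := symbol_four_eq e p
    rw [hr, hr, hr] at h
    ext k
    by_cases hk : k.deg = 4
    · cases k <;> simp [Vtx.deg] at hk
      exacts [h.1, h.2.1, h.2.2]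
    · exact symbol_mem e 4 p k hk
  -- Applying `raise` shows that values of the symbol have no `c0` component. They lie in `l1`,
  -- `l2`, hence come by `lower` from degree 4, where e vanishes. Degree 5 is dual, with `e1` and
  -- `r2`, `r3`.
  have h3 (p) : symbol e 3 p = 0 := by
    refine hidem 3 (fun p hp => ?_) p
    have h0 : symbol e 3 p .c0 = 0 := by
      have := symbol_raise e hp
      rw [h4] at this
      exact (congr_fun this .u1).symm
    rw [← symbol_congr e (p := lower V (Pi.single .u1 (symbol e 3 p .l1) +
      Pi.single .u2 (symbol e 3 p .l2))), symbol_lower e (n := 3), h4, map_zero]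
    · exact add_mem (single_mem .u1 rfl _) (single_mem .u2 rfl _)
    · intro k hk
      cases k <;> simp [Vtx.deg] at hk <;> simp [lower, h0]
  have h5 (p) : symbol e 5 p = 0 := by
    refine hidem 5 (fun p hp => ?_) p
    have h0 : symbol e 5 p .e1 = 0 := by
      have := symbol_lower e (n := 4) hp
      rw [h4] at this
      exact (congr_fun this .u1).symm
    rw [← symbol_congr e (p := raise V (Pi.single .u2 (symbol e 5 p .r2) +
      Pi.single .u3 (symbol e 5 p .r3))), symbol_raise e (n := 4), h4, map_zero]
    · exact add_mem (single_mem .u2 rfl _) (single_mem .u3 rfl _)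
    · intro k hk
      cases k <;> simp [Vtx.deg] at hk <;> simp [raise, h0]
  -- Degrees 2 and 1 are images of `lower`, and degrees 6 and 7 are images of `raise`, so the
  -- vanishing spreads outwards.
  have h2 (p) : symbol e 2 p = 0 := by
    rw [← symbol_congr e (p := lower V (Pi.single .c0 (p .c1) + Pi.single .l1 (p .k1))),
      symbol_lower e (n := 2), h3, map_zero]
    · exact add_mem (single_mem .c0 rfl _) (single_mem .l1 rfl _)
    · intro k hk
      cases k <;> simp [Vtx.deg] at hk <;> simp [lower]
  have h1 (p) : symbol e 1 p = 0 := by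
    rw [← symbol_congr e (p := lower V (Pi.single .c1 (p .c2))),
      symbol_lower e (n := 1) (single_mem .c1 rfl _), h2, map_zero]
    intro k hk
    cases k <;> simp [Vtx.deg] at hk; simp [lower]
  have h6 (p) : symbol e 6 p = 0 := by
    rw [← symbol_congr e (p := raise V (Pi.single .e1 (p .e2) + Pi.single .r3 (p .s3))),
      symbol_raise e (n := 5), h5, map_zero]
    · exact add_mem (single_mem .e1 rfl _) (single_mem .r3 rfl _)
    · intro k hk
      cases k <;> simp [Vtx.deg] at hk <;> simp [raise]
  have h7 (p) : symbol e 7 p = 0 := by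
    rw [← symbol_congr e (p := raise V (Pi.single .e2 (p .e3))),
      symbol_raise e (n := 6) (single_mem .e2 rfl _), h6, map_zero]
    intro k hk
    cases k <;> simp [Vtx.deg] at hk; simp [raise]
  refine eq_zero_of_symbol fun n p => ?_
  by_cases hn : n = 0 ∨ 8 ≤ n
  · exact eq_zero_of_mem_degree (symbol_mem e n p) (by omega)
  · push Not at hn
    obtain ⟨hn0, hn8⟩ := hn
    interval_cases n
    exacts [absurd rfl hn0, h1 p, h2 p, h3 p, h4 p, h5 p, h6 p, h7 p]

end Symbol

end GridModule

/-! ### Indecomposability in terms of idempotents -/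

section Categorical

variable {C : Type*} [Category* C] [Abelian C]

/-- An idempotent endomorphism of an indecomposable object is `0` or `1`. -/
lemma idem_eq_zero_or_one {X : C} (hX : Indecomposable X) (e : X ⟶ X) (he : e ≫ e = e) :
    e = 0 ∨ e = 𝟙 X := by
  have h1 : (𝟙 X - e) ≫ e = 0 := by simp [he]
  have h2 : e ≫ (𝟙 X - e) = 0 := by simp [he]
  let i : X ≅ kernel e ⊞ kernel (𝟙 X - e) :=
    { hom := biprod.lift (kernel.lift e _ h1) (kernel.lift (𝟙 X - e) _ h2)
      inv := biprod.desc (kernel.ι e) (kernel.ι (𝟙 X - e))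
      hom_inv_id := by simp
      inv_hom_id := by
        have k1 : kernel.ι e ≫ e = 0 := kernel.condition e
        have k2 : kernel.ι (𝟙 X - e) ≫ e = kernel.ι (𝟙 X - e) := by
          have := kernel.condition (𝟙 X - e)
          rw [Preadditive.comp_sub, Category.comp_id, sub_eq_zero] at this
          exact this.symm
        ext <;> simp [k1, k2] }
  rcases hX.2 _ _ i with h | h
  · right
    have : kernel.lift e _ h1 = 0 := h.eq_of_tgt _ _
    have h3 : 𝟙 X - e = 0 := by rw [← kernel.lift_ι e _ h1, this, zero_comp]
    exact (sub_eq_zero.mp h3).symm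
  · left
    have : kernel.lift (𝟙 X - e) _ h2 = 0 := h.eq_of_tgt _ _
    rw [← kernel.lift_ι (𝟙 X - e) _ h2, this, zero_comp]

/-- A decomposition provides the projection to its first summand; if this is 0 or 1, one summand
vanishes. -/
lemma indecomposable_of_idem {X : C} (h0 : 𝟙 X ≠ 0)
    (h : ∀ e : X ⟶ X, e ≫ e = e → e = 0 ∨ e = 𝟙 X) :
    Indecomposable X := by
  refine ⟨fun hX => h0 (hX.eq_of_src _ _), fun Y Z i => ?_⟩
  rcases h (i.hom ≫ biprod.fst ≫ biprod.inl ≫ i.inv) (by simp) with h | h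
  · left
    rw [IsZero.iff_id_eq_zero]
    have : biprod.inl ≫ i.inv ≫ (i.hom ≫ biprod.fst ≫ biprod.inl ≫ i.inv) ≫ i.hom ≫ biprod.fst =
      (0 : Y ⟶ Y) := by rw [h]; simp
    simpa using this
  · right
    rw [IsZero.iff_id_eq_zero]
    have : biprod.inr ≫ i.inv ≫ (i.hom ≫ biprod.fst ≫ biprod.inl ≫ i.inv) ≫ i.hom ≫ biprod.snd =
      𝟙 Z := by rw [h]; simp
    simpa using this.symm

end Categorical

section Subcategory

variable {C : Type*} [Category* C] [Abelian C] (P : ObjectProperty C) [P.ContainsZero]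
  [P.IsClosedUnderKernels] [P.IsClosedUnderCokernels] [P.IsClosedUnderFiniteProducts]

lemma preservesFiniteLimits_ι : PreservesFiniteLimits P.ι :=
  have := P.preservesKernels_ι
  Functor.preservesFiniteLimits_of_preservesKernels P.ι

lemma preservesFiniteColimits_ι : PreservesFiniteColimits P.ι :=
  have := P.preservesCokernels_ι
  Functor.preservesFiniteColimits_of_preservesCokernels P.ι

end Subcategory

/-! ### The exact functor and wildness -/

section Functor

variable {q : ℂˣ} (hq : ∀ n : ℕ, 0 < n → q ^ n ≠ 1)

open scoped ModuleCat

/-- The functor from representations of the free algebra to `U_q(𝔰)`-modules. -/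
noncomputable def gridFunctor : ModuleCat.{0} FreeTwo ⥤ ModuleCat.{0} (Uq q) where
  obj V := ModuleCat.of (Uq q) (GridModule hq V)
  map φ := ModuleCat.ofHom (GridModule.map hq φ.hom)
  map_id _ := rfl
  map_comp _ _ := rfl

instance : (gridFunctor hq).Additive where
  map_add := rfl

/-- A homomorphism acts on each coordinate separately, so preimages can be chosen value by value. -/
lemma gridFunctor_exact (S : ShortComplex (ModuleCat.{0} FreeTwo)) (hS : S.Exact) :
    (S.map (gridFunctor hq)).Exact := by
  rw [ShortComplex.moduleCat_exact_iff] at hS ⊢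
  intro f hf
  have hf (i j : ℤ) (k : Vtx) : S.g (GridModule.fn (hq := hq) (V := S.X₂) f i j k) = 0 :=
    congr_fun (congr_fun (congr_fun (congr_arg (GridModule.fn (hq := hq) (V := S.X₃)) hf) i) j) k
  -- The preimage of 0 is chosen to be 0, so that the lifted function keeps the support and degree
  -- conditions. Linearity of the choice is irrelevant.
  have hS' : ∀ v : S.X₂, ∃ w : S.X₁, (S.g v = 0 → S.f w = v) ∧ (v = 0 → w = 0) := by
    intro v
    by_cases h0 : v = 0
    · exact ⟨0, fun _ => by rw [h0]; exact map_zero S.f.hom, fun _ => rfl⟩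
    · by_cases hv : S.g v = 0
      · obtain ⟨w, hw⟩ := hS v hv
        exact ⟨w, fun _ => hw, fun h => absurd h h0⟩
      · exact ⟨0, fun h => absurd h hv, fun _ => rfl⟩
  choose s hs hs0 using hS'
  have hm := GridModule.fn_mem (hq := hq) (V := S.X₂) f
  refine ⟨⟨fun i j k => s (GridModule.fn (hq := hq) (V := S.X₂) f i j k), fun i j =>
    ⟨fun k hk => hs0 _ ((hm i j).1 k hk), fun h => funext fun k => hs0 _ ?_⟩⟩, ?_⟩
  · rw [(hm i j).2 h]; rfl
  · refine GridModule.ext (hq := hq) (V := S.X₂) ?_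
    ext i j k
    exact hs _ (hf i j k)

lemma isA_gridFunctor (V : ModuleCat.{0} FreeTwo) [FiniteDimensional ℂ V] :
    isA q ((gridFunctor hq).obj V) := by
  -- The two sides carry different scalar structures over ℂ, through the algebra on the left and
  -- pointwise on the right; the identity transports the property.
  let φ : (gridFunctor hq).obj V →ₗ[Uq q] GridModule hq V := LinearMap.id
  exact IsCategoryA.of_injective q φ Function.injective_id (GridModule.isCategoryA hq V)

lemma isA_le_isFD : isA q ≤ isFD (Uq q) := fun _ h => h.finite

lemma isA_le_isO0 : isA q ≤ isO0 q := fun M h => by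
  have := h.finite
  refine ⟨⟨?_, h.typeOne.1, fun _ => inferInstance⟩, fun v => ⟨1, by rw [pow_one, h.zero]⟩⟩
  exact Module.Finite.of_restrictScalars_finite ℂ (Uq q) M

variable (P : ObjectProperty (ModuleCat.{0} (Uq q))) (hP : isA q ≤ P)

/-- The functor `gridFunctor` on finite-dimensional representations. -/
noncomputable def gridFunctorFD : FDMod FreeTwo ⥤ P.FullSubcategory :=
  P.lift ((isFD FreeTwo).ι ⋙ gridFunctor hq) fun V =>
    hP _ (by have : FiniteDimensional ℂ V.obj := V.property; exact isA_gridFunctor hq V.obj)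

lemma gridFunctorFD_exact : exactFunctor _ _ (gridFunctorFD hq P hP) := by
  obtain ⟨h1, h2⟩ := (Functor.exact_tfae (gridFunctor hq)).out 1 3 |>.mp (gridFunctor_exact hq)
  have h3 := preservesFiniteLimits_ι (isFD FreeTwo)
  have h4 := preservesFiniteColimits_ι (isFD FreeTwo)
  have h5 : PreservesFiniteLimits (gridFunctorFD hq P hP ⋙ P.ι) :=
    comp_preservesFiniteLimits (isFD FreeTwo).ι (gridFunctor hq)
  have h6 : PreservesFiniteColimits (gridFunctorFD hq P hP ⋙ P.ι) :=
    comp_preservesFiniteColimits (isFD FreeTwo).ι (gridFunctor hq)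
  exact ⟨preservesFiniteLimits_of_reflects_of_preserves _ P.ι,
    preservesFiniteColimits_of_reflects_of_preserves _ P.ι⟩

/-- The homomorphism of representations underlying a morphism between their images. -/
noncomputable def residueHom {V W : FDMod FreeTwo}
    (g : (gridFunctorFD hq P hP).obj V ⟶ (gridFunctorFD hq P hP).obj W) : V ⟶ W :=
  (isFD FreeTwo).homMk (ModuleCat.ofHom
    (GridModule.residue (V := V.obj) (W := W.obj) (hq := hq) g.hom.hom))

lemma residueHom_id (V : FDMod FreeTwo) :
    residueHom hq P hP (𝟙 ((gridFunctorFD hq P hP).obj V)) = 𝟙 V := by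
  ext1
  exact ModuleCat.hom_ext GridModule.residue_id

lemma residueHom_comp {U V W : FDMod FreeTwo}
    (g : (gridFunctorFD hq P hP).obj U ⟶ (gridFunctorFD hq P hP).obj V)
    (h : (gridFunctorFD hq P hP).obj V ⟶ (gridFunctorFD hq P hP).obj W) :
    residueHom hq P hP (g ≫ h) = residueHom hq P hP g ≫ residueHom hq P hP h := by
  ext1
  exact ModuleCat.hom_ext (GridModule.residue_comp _ _)

lemma eq_zero_of_residueHom {V : FDMod FreeTwo}
    {e : (gridFunctorFD hq P hP).obj V ⟶ (gridFunctorFD hq P hP).obj V} (he : e ≫ e = e)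
    (h : residueHom hq P hP e = 0) : e = 0 := by
  have h1 : GridModule.residue (V := V.obj) (W := V.obj) (hq := hq) e.hom.hom = 0 :=
    congr_arg (fun φ : V ⟶ V => φ.hom.hom) h
  have h2 := congr_arg (fun φ => φ.hom.hom) he
  ext1
  exact ModuleCat.hom_ext (GridModule.eq_zero_of_residue h2 h1)

lemma residueHom_sub {V W : FDMod FreeTwo}
    (g h : (gridFunctorFD hq P hP).obj V ⟶ (gridFunctorFD hq P hP).obj W) :
    residueHom hq P hP (g - h) = residueHom hq P hP g - residueHom hq P hP h := by
  ext1
  exact ModuleCat.hom_ext (GridModule.residue_sub _ _)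

variable [P.ContainsZero] [P.IsClosedUnderSubobjects] [P.IsClosedUnderQuotients]
  [P.IsClosedUnderFiniteProducts]

include hq hP in
/-- Every class of `U_q(𝔰)`-modules which contains `𝒜` and is closed under submodules, quotients
and finite products is wild. -/
lemma isWild_of_isA_le : IsWild P.FullSubcategory := by
  refine ⟨gridFunctorFD hq P hP, gridFunctorFD_exact hq P hP, ⟨fun {V W} φ c => ?_⟩,
    fun V hV => ?_, fun V W h => ⟨fun i => h.false ?_⟩⟩
  · ext1
    refine ModuleCat.hom_ext (LinearMap.ext fun f => ?_)
    exact (algebraMap_smul (Uq q) c (GridModule.map hq φ.hom.hom f)).symm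
  · refine indecomposable_of_idem (fun h => hV.1 ?_) fun e he => ?_
    -- The residue of 0 is computed as that of 0 - 0, from compatibility with differences.
    · rw [IsZero.iff_id_eq_zero, ← residueHom_id hq P hP, h, ← sub_self 0, residueHom_sub,
        sub_self]
    · rcases idem_eq_zero_or_one hV (residueHom hq P hP e) (by rw [← residueHom_comp, he])
        with h | h
      · exact .inl (eq_zero_of_residueHom hq P hP he h)
      · right
        have h1 : residueHom hq P hP (𝟙 _ - e) = 0 := by
          rw [residueHom_sub, h, residueHom_id, sub_self]
        exact (sub_eq_zero.mp (eq_zero_of_residueHom hq P hP (by simp [he]) h1)).symm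
  · exact
      { hom := residueHom hq P hP i.hom
        inv := residueHom hq P hP i.inv
        hom_inv_id := by rw [← residueHom_comp, i.hom_inv_id, residueHom_id]
        inv_hom_id := by rw [← residueHom_comp, i.inv_hom_id, residueHom_id] }

end Functor
end QuantumSchrodinger

open QuantumSchrodinger in
theorem mainTheorem3 (q : ℂˣ) (hq : ∀ n : ℕ, 0 < n → q ^ n ≠ 1) :
    IsWild (CatA q) ∧ IsWild (CatO0 q) ∧ IsWild (FDMod (Uq q)) :=
  ⟨isWild_of_isA_le hq _ le_rfl, isWild_of_isA_le hq _ isA_le_isO0,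
    isWild_of_isA_le hq _ isA_le_isFD⟩
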